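/- \textbf{Theorem.} An entourage on a set $X$ is a reflexive symmetric relation $\varepsilon\subset X\times X$; put $B(x,\varepsilon)=\{y:(x,y)\in\varepsilon\}$ and $B(A,\varepsilon)=\bigcup_{a\in A}B(a,\varepsilon)$. A ballean is a set $X$ with a non-empty family $\mathcal E_X$ of entourages (called radii) such that $\bigcup\mathcal E_X=X\times X$ and the composition of any two radii is contained in a radius. Let ${\downarrow}\mathcal E_X$ be the family of all entourages contained in a radius; a base of ${\downarrow}\mathcal E_X$ is a subfamily $\mathcal B\subset{\downarrow}\mathcal E_X$ such that every member of ${\downarrow}\mathcal E_X$ is contained in a member of $\mathcal B$. Let $\mathrm{cof}(X)$ be the smallest cardinality of a base of ${\downarrow}\mathcal E_X$. For $A\subset X$ let $\mathrm{cov}_\varepsilon(A)=\min\{|C|:C\subset X,\ A\subset B(C,\varepsilon)\}$, and let $\mathrm{cov}^\sharp(X)$ be the smallest cardinal $\kappa$ for which there is $\varepsilon\in\mathcal E_X$ such that $\sup_{x\in X}\mathrm{cov}_\varepsilon(B(x,\delta))<\kappa$ for every $\delta\in\mathcal E_X$. The ballean $X$ is \emph{cellular} if ${\downarrow}\mathcal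 E_X$ has a base of equivalence relations, and \emph{ordinal} if ${\downarrow}\mathcal E_X$ has a base $\{B_\alpha\}_{\alpha<\kappa}\subset\mathcal E_X$, indexed by an ordinal $\kappa$, with $B_\alpha\subset B_\beta$ for $\alpha<\beta<\kappa$. A subset $A\subset X$ is a ballean (a subspace of $X$) with radii $\varepsilon\cap A^2$, $\varepsilon\in\mathcal E_X$. A subset $L\subset X$ is \emph{large} if $X=B(L,\varepsilon)$ for some $\varepsilon\in\mathcal E_X$. A map between balleans is \emph{coarse} if it maps each radius into a radius. Two balleans are \emph{coarsely equivalent} if they contain large subspaces between which there is a bijection that is coarse together with its inverse. A multi-map $\Phi:X\multimap Y$ is a subset of $X\times Y$; write $\Phi(x)=\{y:(x,y)\in\Phi\}$ and $\omega_\Phi(\varepsilon)=\bigcup_{(x,x')\in\varepsilon}\Phi(x)\times\Phi(x')$. It is \emph{coarse} if each $\omega_\Phi(\varepsilon)$, $\varepsilon\in\mathcal E_X$, is contained in some radius of $Y$, and $\varphi$-\emph{coarse}, for $\varphi:\mathcal E_X\to\mathcal E_Y$, if $\omega_\Phi(\varepsilon)\subset\varphi(\varepsilon)$ for all $\varepsilon\in\mathcal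 E_X$. It is a \emph{coarse equivalence} if $\Phi^{-1}(Y)=X$, $\Phi(X)=Y$ and both $\Phi$ and $\Phi^{-1}$ are coarse. The ballean $X$ is \emph{homogeneous} if there is $\varphi:\mathcal E_X\to\mathcal E_X$ such that for all $x,y\in X$ there is a coarse equivalence $\Phi:X\multimap X$ with $y\in\Phi(x)$ for which $\Phi$ and $\Phi^{-1}$ are $\varphi$-coarse. Let $X$ and $Y$ be homogeneous cellular ordinal balleans. Then the following conditions are equivalent: (1) $X$ and $Y$ are coarsely equivalent; (2) $X$ is coarsely equivalent to a subspace of $Y$, and $Y$ is coarsely equivalent to a subspace of $X$; (3) $\mathrm{cof}(X)=\mathrm{cof}(Y)$ and $\mathrm{cov}^\sharp(X)=\mathrm{cov}^\sharp(Y)$. -/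

import Mathlib

open Cardinal

universe u

/-- A ballean structure on `X`: a family of entourages (reflexive symmetric relations), called
radii, whose union is `X × X` and such that the composition of any two radii is contained in a
radius. -/
structure Ballean (X : Type u) where
  radii : Set (SetRel X X)
  isRefl : ∀ ε ∈ radii, ε.IsRefl
  isSymm : ∀ ε ∈ radii, ε.IsSymm
  sUnion_radii : ⋃₀ radii = Set.univ
  exists_comp_subset : ∀ ε ∈ radii, ∀ δ ∈ radii, ∃ η ∈ radii, ε.comp δ ⊆ η

/-- The `ε`-neighbourhood `B(A, ε) = {y | ∃ a ∈ A, (a, y) ∈ ε}` of a set `A`. -/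
def entBall {X : Type u} (ε : SetRel X X) (A : Set X) : Set X := {y | ∃ a ∈ A, (a, y) ∈ ε}

/-- The covering number `cov_ε(A)`: the smallest cardinality of a set `C ⊆ X` with
`A ⊆ B(C, ε)`. -/
noncomputable def entCov {X : Type u} (ε : SetRel X X) (A : Set X) : Cardinal.{u} :=
  sInf {c | ∃ C : Set X, A ⊆ entBall ε C ∧ c = #C}

/-- The `ε`-oscillation `⋃_{(x, x') ∈ ε} Φ(x) × Φ(x')` of a multi-map `Φ ⊆ X × Y`. -/
def multimapOsc {X Y : Type u} (Φ : SetRel X Y) (ε : SetRel X X) : SetRel Y Y :=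
  {p | ∃ x x', (x, x') ∈ ε ∧ (x, p.1) ∈ Φ ∧ (x', p.2) ∈ Φ}

namespace Ballean

variable {X Y : Type u}

/-- The coarse structure `↓E` generated by the radii: all entourages contained in a radius. -/
def coarseStructure (E : Ballean X) : Set (SetRel X X) :=
  {δ | δ.IsRefl ∧ δ.IsSymm ∧ ∃ ε ∈ E.radii, δ ⊆ ε}

/-- `B` is a base of the coarse structure `↓E`: it consists of members of `↓E`, and each member
of `↓E` is contained in a member of `B`. -/
def IsBase (E : Ballean X) (B : Set (SetRel X X)) : Prop :=
  B ⊆ E.coarseStructure ∧ ∀ δ ∈ E.coarseStructure, ∃ β ∈ B, δ ⊆ β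

/-- The cofinality: the smallest cardinality of a base of the coarse structure. -/
noncomputable def cof (E : Ballean X) : Cardinal.{u} :=
  sInf {c | ∃ B : Set (SetRel X X), E.IsBase B ∧ c = #B}

/-- `cov^♯`: the smallest cardinal `κ` for which there is a radius `ε` such that
`sup_x cov_ε(B(x, δ)) < κ` for every radius `δ`. -/
noncomputable def covSharp (E : Ballean X) : Cardinal.{u} :=
  sInf {κ | ∃ ε ∈ E.radii, ∀ δ ∈ E.radii, ⨆ x : X, entCov ε (entBall δ {x}) < κ}

/-- The coarse structure has a base `{B α}_{α < κ}` of radii that is indexed by an ordinal and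
increasing. -/
def IsOrdinal (E : Ballean X) : Prop :=
  ∃ (κ : Ordinal.{u}) (B : Set.Iio κ → SetRel X X),
    Monotone B ∧ (∀ α, B α ∈ E.radii) ∧ E.IsBase (Set.range B)

/-- The coarse structure has a base consisting of equivalence relations (members of a base are
already reflexive and symmetric). -/
def IsCellular (E : Ballean X) : Prop :=
  ∃ B : Set (SetRel X X), E.IsBase B ∧ ∀ β ∈ B, β.IsTrans

/-- The subballean on `A ⊆ X`, with radii `ε ∩ A²`. -/
def sub (E : Ballean X) (A : Set X) : Ballean A where
  radii := (fun ε : SetRel X X => {p : A × A | ((p.1 : X), (p.2 : X)) ∈ ε}) '' E.radii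
  isRefl := by
    rintro _ ⟨ε, hε, rfl⟩
    exact ⟨fun a => (E.isRefl ε hε).refl (a : X)⟩
  isSymm := by
    rintro _ ⟨ε, hε, rfl⟩
    exact ⟨fun a b h => (E.isSymm ε hε).symm (a : X) (b : X) h⟩
  sUnion_radii := by
    refine Set.eq_univ_of_forall fun p => ?_
    have h : ((p.1 : X), (p.2 : X)) ∈ ⋃₀ E.radii := E.sUnion_radii ▸ Set.mem_univ _
    obtain ⟨ε, hε, hp⟩ := h
    exact ⟨_, ⟨ε, hε, rfl⟩, hp⟩
  exists_comp_subset := by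
    rintro _ ⟨ε, hε, rfl⟩ _ ⟨δ, hδ, rfl⟩
    obtain ⟨η, hη, h⟩ := E.exists_comp_subset ε hε δ hδ
    refine ⟨_, ⟨η, hη, rfl⟩, ?_⟩
    rintro ⟨a, c⟩ ⟨b, hab, hbc⟩
    exact h ⟨(b : X), hab, hbc⟩

/-- A map is coarse if it maps each radius into a radius. -/
def IsCoarseMap (E : Ballean X) (F : Ballean Y) (f : X → Y) : Prop :=
  ∀ ε ∈ E.radii, ∃ δ ∈ F.radii, ∀ x x', (x, x') ∈ ε → (f x, f x') ∈ δ

/-- There is a bijection that is coarse in both directions. -/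
def CoarselyIsomorphic (E : Ballean X) (F : Ballean Y) : Prop :=
  ∃ f : X ≃ Y, E.IsCoarseMap F f ∧ F.IsCoarseMap E f.symm

/-- `L` is large if `X = B(L, ε)` for some radius `ε`. -/
def IsLarge (E : Ballean X) (L : Set X) : Prop :=
  ∃ ε ∈ E.radii, entBall ε L = Set.univ

/-- Two balleans are coarsely equivalent if they contain coarsely isomorphic large subspaces. -/
def CoarselyEquivalent (E : Ballean X) (F : Ballean Y) : Prop :=
  ∃ (L : Set X) (M : Set Y), E.IsLarge L ∧ F.IsLarge M ∧
    (E.sub L).CoarselyIsomorphic (F.sub M)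

/-- `Φ` is `φ`-coarse for a function `φ` between the sets of radii. -/
def IsCoarseWith (E : Ballean X) (F : Ballean Y) (φ : E.radii → F.radii)
    (Φ : SetRel X Y) : Prop :=
  ∀ ε : E.radii, multimapOsc Φ ε ⊆ (φ ε : SetRel Y Y)

/-- A multi-map is coarse if each oscillation is contained in a radius. -/
def IsCoarseMultimap (E : Ballean X) (F : Ballean Y) (Φ : SetRel X Y) : Prop :=
  ∀ ε ∈ E.radii, ∃ δ ∈ F.radii, multimapOsc Φ ε ⊆ δ

/-- A multi-map `Φ` is a coarse equivalence if `Φ⁻¹(Y) = X`, `Φ(X) = Y` and both `Φ` and `Φ⁻¹`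
are coarse. -/
def IsCoarseEquivalence (E : Ballean X) (F : Ballean Y) (Φ : SetRel X Y) : Prop :=
  Φ.dom = Set.univ ∧ Φ.cod = Set.univ ∧
    E.IsCoarseMultimap F Φ ∧ F.IsCoarseMultimap E Φ.inv

/-- A ballean is homogeneous if, for some function `φ` on the radii, any two points `x`, `y`
admit a coarse equivalence `Φ` of `X` with itself such that `y ∈ Φ(x)` and both `Φ` and `Φ⁻¹`
are `φ`-coarse. -/
def IsHomogeneous (E : Ballean X) : Prop :=
  ∃ φ : E.radii → E.radii, ∀ x y : X, ∃ Φ : SetRel X X,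
    E.IsCoarseEquivalence E Φ ∧ (x, y) ∈ Φ ∧
      E.IsCoarseWith E φ Φ ∧ E.IsCoarseWith E φ Φ.inv

end Ballean

/-! Both invariants are monotone under coarse embeddings: bases of the coarse structure pull back,
and so do the centres of a covering, at the cost of one composition of radii. This gives (1) ⇒ (2) ⇒
(3); the content is (3) ⇒ (1).

Cellularity allows working with small equivalence relations and counting the classes of a fixed
small `s₀` inside the classes of coarser ones. For a suitable `s₀` these counts have, for each small
relation, a bound below cov♯. Homogeneity makes them reach any given cardinal below cov♯ at all
points simultaneously (`IsHomogeneous.exists_le_classCount`). Ordinality keeps joins of fewer than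
cof small relations small (`IsCellular.isSmall_iSup`).

If cof is finite, some radius is everything, and only emptiness matters, which cov♯ detects.

If cof is infinite and cov♯ > ℵ₀, cofinal towers of length cof are built in both balleans at once,
such that at each level every class splits into exactly the same infinite number of classes of the
join of the lower levels. Infinite cardinal arithmetic makes exact splitting possible
(`exists_setoid_isLabelling`). A tower of this kind identifies the points, up to `s₀`, with the
finitely supported elements of a product (`exists_coordinates`), and equal coordinates define the
equivalence.

If cov♯ ≤ ℵ₀, then cof = ℵ₀ and the counts are finite, so that they cannot be matched exactly: one
tower may split in powers of 2, the other in powers of 3. Instead the classes become intervals of ℕ,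
and each tower becomes a sequence of ever sparser cut sets. The two sequences are alternated, with
blocks growing so fast that rounding costs only a small relative error, and are linked by maps whose
two-step composites are the exact inclusions of cuts (`exists_interleaving`). -/

namespace Ballean

/-! ### Coarse embeddings and monotonicity of the two invariants -/

variable {X Y : Type u} {Z : Type u}

theorem radius_refl (E : Ballean X) {ε : SetRel X X} (hε : ε ∈ E.radii) (x : X) : (x, x) ∈ ε :=
  (E.isRefl ε hε).refl x

theorem radius_symm (E : Ballean X) {ε : SetRel X X} (hε : ε ∈ E.radii) {x y : X}
    (h : (x, y) ∈ ε) : (y, x) ∈ ε :=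
  (E.isSymm ε hε).symm x y h

theorem exists_radius_mem (E : Ballean X) (x y : X) : ∃ ε ∈ E.radii, (x, y) ∈ ε := by
  have h : (x, y) ∈ ⋃₀ E.radii := E.sUnion_radii ▸ Set.mem_univ _
  exact h

theorem exists_radius_comp (E : Ballean X) {ε δ : SetRel X X} (hε : ε ∈ E.radii)
    (hδ : δ ∈ E.radii) :
    ∃ η ∈ E.radii, ∀ x y z, (x, y) ∈ ε → (y, z) ∈ δ → (x, z) ∈ η := by
  obtain ⟨η, hη, h⟩ := E.exists_comp_subset ε hε δ hδ
  exact ⟨η, hη, fun x y z hxy hyz => h ⟨y, hxy, hyz⟩⟩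

theorem exists_radius_union (E : Ballean X) {ε δ : SetRel X X} (hε : ε ∈ E.radii)
    (hδ : δ ∈ E.radii) : ∃ η ∈ E.radii, ε ⊆ η ∧ δ ⊆ η := by
  obtain ⟨η, hη, h⟩ := E.exists_radius_comp hε hδ
  exact ⟨η, hη, fun p hp => h _ _ _ hp (E.radius_refl hδ _),
    fun p hp => h _ _ _ (E.radius_refl hε _) hp⟩

theorem radius_mem_coarseStructure (E : Ballean X) {ε : SetRel X X} (hε : ε ∈ E.radii) :
    ε ∈ E.coarseStructure :=
  ⟨E.isRefl ε hε, E.isSymm ε hε, ε, hε, subset_rfl⟩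

/-- A coarse map such that preimages of radii are contained in radii. -/
def IsCoarseEmbedding (E : Ballean X) (F : Ballean Y) (f : X → Y) : Prop :=
  E.IsCoarseMap F f ∧ ∀ δ ∈ F.radii, ∃ ε ∈ E.radii, ∀ x x', (f x, f x') ∈ δ → (x, x') ∈ ε

theorem IsCoarseEmbedding.comp {E : Ballean X} {F : Ballean Y} {G : Ballean Z} {f : X → Y}
    {g : Y → Z} (hg : F.IsCoarseEmbedding G g) (hf : E.IsCoarseEmbedding F f) :
    E.IsCoarseEmbedding G (g ∘ f) := by
  refine ⟨fun ε hε => ?_, fun ε hε => ?_⟩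
  · obtain ⟨δ, hδ, h⟩ := hf.1 ε hε
    obtain ⟨η, hη, h'⟩ := hg.1 δ hδ
    exact ⟨η, hη, fun x x' hx => h' _ _ (h _ _ hx)⟩
  · obtain ⟨δ, hδ, h⟩ := hg.2 ε hε
    obtain ⟨η, hη, h'⟩ := hf.2 δ hδ
    exact ⟨η, hη, fun x x' hx => h' _ _ (h _ _ hx)⟩

theorem isCoarseEmbedding_subtype_val (F : Ballean Y) (A : Set Y) :
    (F.sub A).IsCoarseEmbedding F Subtype.val := by
  refine ⟨?_, fun δ hδ => ⟨_, ⟨δ, hδ, rfl⟩, fun x x' h => h⟩⟩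
  rintro _ ⟨ε, hε, rfl⟩
  exact ⟨ε, hε, fun x x' h => h⟩

theorem CoarselyEquivalent.symm {E : Ballean X} {F : Ballean Y} (h : E.CoarselyEquivalent F) :
    F.CoarselyEquivalent E := by
  obtain ⟨L, M, hL, hM, f, hf, hf'⟩ := h
  exact ⟨M, L, hM, hL, f.symm, hf', hf⟩

theorem CoarselyEquivalent.exists_isCoarseEmbedding {E : Ballean X} {F : Ballean Y}
    (h : E.CoarselyEquivalent F) :
    ∃ f : X → Y, E.IsCoarseEmbedding F f ∧ ∃ δ ∈ F.radii, ∀ y, ∃ x, (f x, y) ∈ δ := by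
  obtain ⟨L, M, ⟨ε, hε, hL⟩, ⟨δ, hδ, hM⟩, f, hf, hf'⟩ := h
  have hr : ∀ x, ∃ a : L, ((a : X), x) ∈ ε := by
    intro x
    have : x ∈ entBall ε L := hL ▸ Set.mem_univ x
    obtain ⟨a, ha, h⟩ := this
    exact ⟨⟨a, ha⟩, h⟩
  choose r hr using hr
  have hs : ∀ y, ∃ a : M, ((a : Y), y) ∈ δ := by
    intro x
    have : x ∈ entBall δ M := hM ▸ Set.mem_univ x
    obtain ⟨a, ha, h⟩ := this
    exact ⟨⟨a, ha⟩, h⟩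
  refine ⟨fun x => f (r x), ⟨fun α hα => ?_, fun α hα => ?_⟩, ?_⟩
  · obtain ⟨β, hβ, h1⟩ := E.exists_radius_comp hε hα
    obtain ⟨γ, hγ, h2⟩ := E.exists_radius_comp hβ hε
    obtain ⟨_, ⟨η, hη, rfl⟩, h3⟩ := hf _ ⟨γ, hγ, rfl⟩
    refine ⟨η, hη, fun x x' hx => h3 _ _ ?_⟩
    exact h2 _ _ _ (h1 _ _ _ (hr x) hx) (E.radius_symm hε (hr x'))
  · obtain ⟨_, ⟨β, hβ, rfl⟩, h1⟩ := hf' _ ⟨α, hα, rfl⟩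
    obtain ⟨γ, hγ, h2⟩ := E.exists_radius_comp hε hβ
    obtain ⟨η, hη, h3⟩ := E.exists_radius_comp hγ hε
    refine ⟨η, hη, fun x x' hx => ?_⟩
    have := h1 _ _ hx
    simp only [Equiv.symm_apply_apply] at this
    exact h3 _ _ _ (h2 _ _ _ (E.radius_symm hε (hr x)) this) (hr x')
  · obtain ⟨_, ⟨β, hβ, rfl⟩, h1⟩ := hf _ ⟨ε, hε, rfl⟩
    obtain ⟨γ, hγ, h2⟩ := F.exists_radius_comp hβ hδ
    refine ⟨γ, hγ, fun y => ?_⟩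
    obtain ⟨a, ha⟩ := hs y
    refine ⟨f.symm a, h2 _ (a : Y) _ ?_ ha⟩
    have := h1 (r (f.symm a)) (f.symm a) (hr _)
    simpa using this

/-- A coarse embedding need not be injective, but its fibres are uniformly bounded. One point from
each fibre gives a large subspace that corresponds bijectively to the range. -/
theorem IsCoarseEmbedding.coarselyEquivalent {E : Ballean X} {F : Ballean Y} {f : X → Y}
    (hf : E.IsCoarseEmbedding F f) (hlarge : ∃ δ ∈ F.radii, ∀ y, ∃ x, (f x, y) ∈ δ) :
    E.CoarselyEquivalent F := by
  obtain ⟨δ, hδ, hl⟩ := hlarge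
  have hg : ∀ m : Set.range f, ∃ x, f x = m := fun m => m.2
  choose g hg using hg
  have ginj : Function.Injective g := fun a b h => Subtype.ext (by rw [← hg a, ← hg b, h])
  let e : Set.range g ≃ Set.range f := (Equiv.ofInjective g ginj).symm
  have he : ∀ a : Set.range g, f a = e a := by
    intro a
    have h1 : (Equiv.ofInjective g ginj) (e a) = a := by simp [e]
    have h2 := congrArg Subtype.val h1
    simp only [Equiv.ofInjective_apply] at h2
    rw [← h2, hg]
  have he' : ∀ b : Set.range f, ((e.symm b : Set.range g) : X) = g b := by
    intro b
    simp [e]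
  refine ⟨Set.range g, Set.range f, ?_, ⟨δ, hδ, ?_⟩, e, ?_, ?_⟩
  · obtain ⟨ε, hε, h⟩ := hf.2 δ hδ
    refine ⟨ε, hε, Set.eq_univ_of_forall fun x => ?_⟩
    refine ⟨g ⟨f x, x, rfl⟩, ⟨_, rfl⟩, h _ _ ?_⟩
    rw [hg]
    exact F.radius_refl hδ _
  · refine Set.eq_univ_of_forall fun y => ?_
    obtain ⟨x, hx⟩ := hl y
    exact ⟨f x, ⟨x, rfl⟩, hx⟩
  · rintro _ ⟨ε, hε, rfl⟩
    obtain ⟨η, hη, h⟩ := hf.1 ε hε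
    refine ⟨_, ⟨η, hη, rfl⟩, fun x x' hx => ?_⟩
    have := h _ _ hx
    rw [he, he] at this
    exact this
  · rintro _ ⟨η, hη, rfl⟩
    obtain ⟨ε, hε, h⟩ := hf.2 η hη
    refine ⟨_, ⟨ε, hε, rfl⟩, fun x x' hx => ?_⟩
    refine h _ _ ?_
    rw [he', he', hg, hg]
    exact hx

theorem CoarselyEquivalent.sub_univ {E : Ballean X} {F : Ballean Y}
    (h : E.CoarselyEquivalent F) : E.CoarselyEquivalent (F.sub Set.univ) := by
  obtain ⟨f, ⟨h1, h2⟩, δ, hδ, h3⟩ := h.exists_isCoarseEmbedding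
  refine IsCoarseEmbedding.coarselyEquivalent (f := fun x => ⟨f x, trivial⟩)
    ⟨fun ε hε => ?_, ?_⟩ ⟨_, ⟨δ, hδ, rfl⟩, fun y => h3 y⟩
  · obtain ⟨η, hη, h⟩ := h1 ε hε
    exact ⟨_, ⟨η, hη, rfl⟩, h⟩
  · rintro _ ⟨η, hη, rfl⟩
    exact h2 η hη

theorem CoarselyEquivalent.exists_isCoarseEmbedding_of_sub {E : Ballean X} {F : Ballean Y}
    {A : Set Y} (h : E.CoarselyEquivalent (F.sub A)) : ∃ f : X → Y, E.IsCoarseEmbedding F f := by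
  obtain ⟨f, hf, -⟩ := h.exists_isCoarseEmbedding
  exact ⟨_, (F.isCoarseEmbedding_subtype_val A).comp hf⟩

theorem isBase_coarseStructure (E : Ballean X) : E.IsBase E.coarseStructure :=
  ⟨subset_rfl, fun δ hδ => ⟨δ, hδ, subset_rfl⟩⟩

theorem exists_isBase_mk_eq_cof (E : Ballean X) : ∃ B, E.IsBase B ∧ E.cof = #B :=
  csInf_mem (s := {c | ∃ B : Set (SetRel X X), E.IsBase B ∧ c = #B})
    ⟨_, _, E.isBase_coarseStructure, rfl⟩

theorem IsBase.cof_le {E : Ballean X} {B : Set (SetRel X X)} (hB : E.IsBase B) : E.cof ≤ #B :=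
  csInf_le' ⟨B, hB, rfl⟩

theorem IsCoarseEmbedding.cof_le {E : Ballean X} {F : Ballean Y} {f : X → Y}
    (hf : E.IsCoarseEmbedding F f) : E.cof ≤ F.cof := by
  obtain ⟨B, hB, hc⟩ := F.exists_isBase_mk_eq_cof
  rw [hc]
  let T : SetRel Y Y → SetRel X X := fun β => {p | (f p.1, f p.2) ∈ β}
  have : E.IsBase (T '' B) := by
    refine ⟨?_, fun δ hδ => ?_⟩
    · rintro _ ⟨β, hβ, rfl⟩
      obtain ⟨hr, hs, η, hη, hβη⟩ := hB.1 hβ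
      obtain ⟨ε, hε, h⟩ := hf.2 η hη
      exact ⟨⟨fun a => hr.refl (f a)⟩, ⟨fun a b hab => hs.symm (f a) (f b) hab⟩, ε, hε,
        fun p hp => h _ _ (hβη hp)⟩
    · obtain ⟨-, -, ε, hε, hδε⟩ := hδ
      obtain ⟨η, hη, h⟩ := hf.1 ε hε
      obtain ⟨β, hβ, hηβ⟩ := hB.2 η (F.radius_mem_coarseStructure hη)
      exact ⟨_, ⟨β, hβ, rfl⟩, fun p hp => hηβ (h _ _ (hδε hp))⟩
  exact this.cof_le.trans mk_image_le

theorem entCov_le {ε : SetRel X X} {A C : Set X} (h : A ⊆ entBall ε C) : entCov ε A ≤ #C :=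
  csInf_le' ⟨C, h, rfl⟩

theorem exists_entCov_eq (E : Ballean X) {ε : SetRel X X} (hε : ε ∈ E.radii) (A : Set X) :
    ∃ C : Set X, A ⊆ entBall ε C ∧ entCov ε A = #C :=
  csInf_mem (s := {c | ∃ C : Set X, A ⊆ entBall ε C ∧ c = #C})
    ⟨_, A, fun a ha => ⟨a, ha, E.radius_refl hε a⟩, rfl⟩

theorem bddAbove_range_cardinal {ι : Type u} (f : ι → Cardinal.{u}) :
    BddAbove (Set.range f) :=
  Cardinal.bddAbove_of_small

theorem covSharp_set_nonempty (E : Ballean X) (hE : E.radii.Nonempty) :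
    {κ : Cardinal.{u} | ∃ ε ∈ E.radii, ∀ δ ∈ E.radii,
      ⨆ x : X, entCov ε (entBall δ {x}) < κ}.Nonempty := by
  obtain ⟨ε, hε⟩ := hE
  refine ⟨Order.succ #X, ε, hε, fun δ hδ => Order.lt_succ_iff.2 (ciSup_le' fun x => ?_)⟩
  refine (entCov_le (C := Set.univ) fun y _ => ⟨y, trivial, E.radius_refl hε y⟩).trans ?_
  simp

theorem exists_radius_covSharp (E : Ballean X) (hE : E.radii.Nonempty) :
    ∃ ε ∈ E.radii, ∀ δ ∈ E.radii, ⨆ x : X, entCov ε (entBall δ {x}) < E.covSharp :=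
  csInf_mem (E.covSharp_set_nonempty hE)

theorem covSharp_le (E : Ballean X) {κ : Cardinal.{u}} {ε : SetRel X X} (hε : ε ∈ E.radii)
    (h : ∀ δ ∈ E.radii, ⨆ x : X, entCov ε (entBall δ {x}) < κ) : E.covSharp ≤ κ :=
  csInf_le' ⟨ε, hε, h⟩

theorem IsCoarseEmbedding.covSharp_le {E : Ballean X} {F : Ballean Y} {f : X → Y}
    (hf : E.IsCoarseEmbedding F f) (hF : F.radii.Nonempty) : E.covSharp ≤ F.covSharp := by
  obtain ⟨η, hη, h⟩ := F.exists_radius_covSharp hF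
  obtain ⟨η', hη', h'⟩ := F.exists_radius_comp hη hη
  obtain ⟨ε, hε, hεη⟩ := hf.2 η' hη'
  refine E.covSharp_le hε fun δ hδ => ?_
  obtain ⟨ζ, hζ, hδζ⟩ := hf.1 δ hδ
  refine lt_of_le_of_lt (ciSup_le' fun x => ?_) (h ζ hζ)
  refine le_trans ?_ (le_ciSup (bddAbove_range_cardinal _) (f x))
  obtain ⟨C, hC, hCc⟩ := F.exists_entCov_eq hη (entBall ζ {f x})
  rw [hCc]
  classical
  -- Each centre close to the range moves to a point of `X` with image close to it. The other
  -- centres cover no point of the range, so their value `x` is immaterial.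
  let g : Y → X := fun c => if hc : ∃ a, (c, f a) ∈ η then hc.choose else x
  have hg : ∀ c a, (c, f a) ∈ η → (c, f (g c)) ∈ η := by
    intro c a hca
    have hc : ∃ a, (c, f a) ∈ η := ⟨a, hca⟩
    simp only [g, dif_pos hc]
    exact hc.choose_spec
  refine (entCov_le (C := g '' C) ?_).trans mk_image_le
  rintro y ⟨x', hx', hy⟩
  rw [Set.mem_singleton_iff.1 hx'] at hy
  obtain ⟨c, hc, hcy⟩ := hC (⟨f x, rfl, hδζ _ _ hy⟩ : f y ∈ entBall ζ {f x})
  exact ⟨g c, ⟨c, hc, rfl⟩, hεη _ _ (h' _ _ _ (F.radius_symm hη (hg c y hcy)) hcy)⟩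

end Ballean

/-! ### Counting classes of small equivalence relations -/

/-- The number of classes of an equivalence relation that meet a set. -/
noncomputable def classCount {X : Type u} (s : Setoid X) (A : Set X) : Cardinal.{u} :=
  #(Quotient.mk s '' A)

theorem classCount_mono {X : Type u} (s : Setoid X) {A B : Set X} (h : A ⊆ B) :
    classCount s A ≤ classCount s B :=
  mk_le_mk_of_subset (Set.image_mono h)

theorem classCount_anti {X : Type u} {s t : Setoid X} (h : s ≤ t) (A : Set X) :
    classCount t A ≤ classCount s A := by
  have : Quotient.mk t '' A = (Quotient.map' id h : Quotient s → Quotient t) ''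
      (Quotient.mk s '' A) := by
    rw [Set.image_image]
    rfl
  rw [classCount, this]
  exact mk_image_le

/-- Each centre reaches points of only one class. -/
theorem classCount_le_entCov {X : Type u} (E : Ballean X) {s : Setoid X} {ε : SetRel X X}
    (hε : ε ∈ E.radii) (h : ∀ x y, (x, y) ∈ ε → s x y) (A : Set X) :
    classCount s A ≤ entCov ε A := by
  obtain ⟨C, hC, hc⟩ := E.exists_entCov_eq hε A
  rw [hc]
  refine (mk_le_mk_of_subset (t := Quotient.mk s '' C) ?_).trans mk_image_le
  rintro _ ⟨a, ha, rfl⟩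
  obtain ⟨c, hc, hca⟩ := hC ha
  exact ⟨c, hc, Quotient.sound (h _ _ hca)⟩

theorem entCov_le_classCount {X : Type u} {s : Setoid X} {ε : SetRel X X}
    (h : ∀ x y, s x y → (x, y) ∈ ε) (A : Set X) : entCov ε A ≤ classCount s A := by
  refine (Ballean.entCov_le (C := Quotient.out '' (Quotient.mk s '' A)) fun a ha => ?_).trans mk_image_le
  exact ⟨_, ⟨_, ⟨a, ha, rfl⟩, rfl⟩, h _ _ (Quotient.mk_out a)⟩

namespace Ballean

variable {X : Type u} {E : Ballean X}

/-- An equivalence relation is small if it is contained in a radius. -/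
def IsSmall (E : Ballean X) (s : Setoid X) : Prop :=
  ∃ ε ∈ E.radii, ∀ x y, s x y → (x, y) ∈ ε

theorem IsCellular.exists_isSmall (hE : E.IsCellular) {ε : SetRel X X} (hε : ε ∈ E.radii) :
    ∃ s, E.IsSmall s ∧ ∀ x y, (x, y) ∈ ε → s x y := by
  obtain ⟨B, hB, ht⟩ := hE
  obtain ⟨β, hβ, h⟩ := hB.2 ε (E.radius_mem_coarseStructure hε)
  obtain ⟨hr, hs, η, hη, hβη⟩ := hB.1 hβ
  exact ⟨⟨fun x y => (x, y) ∈ β, fun x => hr.refl x, fun h => hs.symm _ _ h,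
    fun h h' => (ht β hβ).trans _ _ _ h h'⟩, ⟨η, hη, fun x y h => hβη h⟩, fun x y hxy => h hxy⟩

theorem IsSmall.mono {s t : Setoid X} (ht : E.IsSmall t) (h : s ≤ t) : E.IsSmall s := by
  obtain ⟨ε, hε, h'⟩ := ht
  exact ⟨ε, hε, fun x y hxy => h' x y (h hxy)⟩

theorem IsCellular.exists_le_le (hE : E.IsCellular) {s t : Setoid X} (hs : E.IsSmall s)
    (ht : E.IsSmall t) : ∃ r, E.IsSmall r ∧ s ≤ r ∧ t ≤ r := by
  obtain ⟨ε, hε, h⟩ := hs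
  obtain ⟨δ, hδ, h'⟩ := ht
  obtain ⟨η, hη, h1, h2⟩ := E.exists_radius_union hε hδ
  obtain ⟨r, hr, hr'⟩ := hE.exists_isSmall hη
  exact ⟨r, hr, fun x y hxy => hr' _ _ (h1 (h _ _ hxy)), fun x y hxy => hr' _ _ (h2 (h' _ _ hxy))⟩

theorem IsCellular.isSmall_sup (hE : E.IsCellular) {s t : Setoid X} (hs : E.IsSmall s)
    (ht : E.IsSmall t) : E.IsSmall (s ⊔ t) := by
  obtain ⟨r, hr, h1, h2⟩ := hE.exists_le_le hs ht
  exact hr.mono (sup_le h1 h2)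

theorem IsCellular.exists_isSmall_apply (hE : E.IsCellular) {s : Setoid X} (hs : E.IsSmall s)
    (x y : X) : ∃ t, E.IsSmall t ∧ s ≤ t ∧ t x y := by
  obtain ⟨ε, hε, h⟩ := E.exists_radius_mem x y
  obtain ⟨r, hr, hr'⟩ := hE.exists_isSmall hε
  obtain ⟨t, ht, h1, h2⟩ := hE.exists_le_le hs hr
  exact ⟨t, ht, h1, h2 (hr' _ _ h)⟩

/-- Fewer than cof members of an increasing base cannot form a base. Some entourage therefore
escapes all of them, and by linearity any member of the base containing it lies above them all. -/
theorem IsCellular.isSmall_iSup (hE : E.IsCellular) (hO : E.IsOrdinal) {ι : Type u}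
    (s : ι → Setoid X) (hs : ∀ i, E.IsSmall (s i)) (hι : #ι < E.cof) : E.IsSmall (⨆ i, s i) := by
  obtain ⟨κ, B, hmono, hBr, hB⟩ := hO
  have h1 : ∀ i, ∃ a, ∀ x y, s i x y → (x, y) ∈ B a := by
    intro i
    obtain ⟨ε, hε, h⟩ := hs i
    obtain ⟨_, ⟨a, rfl⟩, ha⟩ := hB.2 ε (E.radius_mem_coarseStructure hε)
    exact ⟨a, fun x y hxy => ha (h x y hxy)⟩
  choose a ha using h1
  have h2 : ¬ E.IsBase (Set.range fun i => B (a i)) := fun h =>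
    absurd (h.cof_le.trans mk_range_le) (not_le.2 hι)
  have h3 : ∃ δ ∈ E.coarseStructure, ∀ i, ¬ δ ⊆ B (a i) := by
    by_contra! hcon
    refine h2 ⟨?_, fun δ hδ => ?_⟩
    · rintro _ ⟨i, rfl⟩
      exact E.radius_mem_coarseStructure (hBr _)
    · obtain ⟨i, hi⟩ := hcon δ hδ
      exact ⟨_, ⟨i, rfl⟩, hi⟩
  obtain ⟨δ, hδ, h4⟩ := h3
  obtain ⟨_, ⟨b, rfl⟩, hb⟩ := hB.2 δ hδ
  obtain ⟨t, ht, htb⟩ := hE.exists_isSmall (hBr b)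
  refine ht.mono (iSup_le fun i x y hxy => htb _ _ ?_)
  rcases le_total (a i) b with hle | hle
  · exact hmono hle (ha i _ _ hxy)
  · exact absurd (hb.trans (hmono hle)) (h4 i)

theorem IsCellular.exists_cofinal (hE : E.IsCellular) {ι : Type*}
    (hι : lift.{u} #ι = lift E.cof) :
    ∃ b : ι → Setoid X, (∀ i, E.IsSmall (b i)) ∧
      ∀ ε ∈ E.radii, ∃ i, ∀ x y, (x, y) ∈ ε → b i x y := by
  obtain ⟨B, hB, hc⟩ := E.exists_isBase_mk_eq_cof
  have e : ι ≃ B := (lift_mk_eq'.1 (hι.trans (by rw [hc]))).some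
  have h1 : ∀ i, ∃ s, E.IsSmall s ∧ ∀ x y, (x, y) ∈ (e i : SetRel X X) → s x y := by
    intro i
    obtain ⟨-, -, ε, hε, h⟩ := hB.1 (e i).2
    obtain ⟨s, hs, h'⟩ := hE.exists_isSmall hε
    exact ⟨s, hs, fun x y hxy => h' _ _ (h hxy)⟩
  choose b hb hb' using h1
  refine ⟨b, hb, fun ε hε => ?_⟩
  obtain ⟨β, hβ, h⟩ := hB.2 ε (E.radius_mem_coarseStructure hε)
  refine ⟨e.symm ⟨β, hβ⟩, fun x y hxy => hb' _ _ _ ?_⟩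
  rw [e.apply_symm_apply]
  exact h hxy

/-- A small relation containing the radius at which cov♯ is attained has at most as many classes in
a set as that radius needs centres. -/
theorem IsCellular.exists_classCount_le (hE : E.IsCellular) (hne : E.radii.Nonempty) :
    ∃ s₀, E.IsSmall s₀ ∧ ∀ s, E.IsSmall s →
      ∃ c < E.covSharp, ∀ x, classCount s₀ {y | s x y} ≤ c := by
  obtain ⟨ε, hε, h⟩ := E.exists_radius_covSharp hne
  obtain ⟨s₀, hs₀, h₀⟩ := hE.exists_isSmall hε
  refine ⟨s₀, hs₀, fun s ⟨δ, hδ, hs⟩ => ⟨_, h δ hδ, fun x => ?_⟩⟩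
  refine le_trans ?_ (le_ciSup (bddAbove_range_cardinal _) x)
  refine (classCount_le_entCov E hε h₀ _).trans' (classCount_mono _ fun y hy => ?_)
  exact ⟨x, rfl, hs _ _ hy⟩

/-- `Φ` carries the ball at `x` into a ball at `y`; a covering of the latter is pulled back through
`Φ⁻¹`. Only `φ` enters the radii, so the estimate is uniform in both points. -/
theorem entCov_le_entCov_of_homogeneous {φ : E.radii → E.radii}
    (h : ∀ x y : X, ∃ Φ : SetRel X X, E.IsCoarseEquivalence E Φ ∧ (x, y) ∈ Φ ∧
      E.IsCoarseWith E φ Φ ∧ E.IsCoarseWith E φ Φ.inv) (ε δ : E.radii) (x y : X) :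
    entCov (φ ε : SetRel X X) (entBall (δ : SetRel X X) {x}) ≤
      entCov (ε : SetRel X X) (entBall (φ δ : SetRel X X) {y}) := by
  obtain ⟨Φ, ⟨hdom, hcod, -, -⟩, hxy, h1, h2⟩ := h x y
  obtain ⟨C, hC, hc⟩ := E.exists_entCov_eq ε.2 (entBall (φ δ : SetRel X X) {y})
  rw [hc]
  have hg : ∀ c, ∃ a, (a, c) ∈ Φ := fun c => by
    have : c ∈ Φ.cod := hcod ▸ Set.mem_univ c
    exact this
  choose g hg using hg
  refine (entCov_le (C := g '' C) ?_).trans mk_image_le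
  rintro z ⟨x', hx', hz⟩
  rw [Set.mem_singleton_iff.1 hx'] at hz
  have : z ∈ Φ.dom := hdom ▸ Set.mem_univ z
  obtain ⟨w, hw⟩ := this
  obtain ⟨c, hc, hcw⟩ := hC (⟨y, rfl, h1 δ ⟨x, z, hz, hxy, hw⟩⟩ :
    w ∈ entBall (φ δ : SetRel X X) {y})
  exact ⟨g c, ⟨c, hc, rfl⟩, h2 ε ⟨c, w, hcw, hg c, hw⟩⟩

theorem IsHomogeneous.exists_le_classCount (hH : E.IsHomogeneous) (hE : E.IsCellular)
    {s : Setoid X} (hs : E.IsSmall s) {c : Cardinal.{u}} (hc : c < E.covSharp) :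
    ∃ t, E.IsSmall t ∧ s ≤ t ∧ ∀ x, c ≤ classCount s {y | t x y} := by
  obtain ⟨φ, hφ⟩ := hH
  have hs' := hs
  obtain ⟨ε, hε, hsε⟩ := hs'
  -- Minimality of cov♯ is applied to the enlarged radius `φ ε`, because passing from `x` to an
  -- arbitrary `y` will replace `φ ε` by `ε`.
  have h1 : ∃ δ ∈ E.radii,
      c ≤ ⨆ x : X, entCov (φ ⟨ε, hε⟩ : SetRel X X) (entBall δ {x}) := by
    by_contra! hcon
    exact absurd (E.covSharp_le (φ ⟨ε, hε⟩).2 hcon) (not_le.2 hc)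
  obtain ⟨δ, hδ, h1⟩ := h1
  obtain ⟨r, hr, hr'⟩ := hE.exists_isSmall (φ ⟨δ, hδ⟩).2
  obtain ⟨t, ht, hst, hrt⟩ := hE.exists_le_le hs hr
  refine ⟨t, ht, hst, fun y => h1.trans (ciSup_le' fun x => ?_)⟩
  refine (entCov_le_entCov_of_homogeneous hφ ⟨ε, hε⟩ ⟨δ, hδ⟩ x y).trans ?_
  refine (entCov_le_classCount hsε _).trans (classCount_mono _ ?_)
  rintro z ⟨y', hy', hz⟩
  rw [Set.mem_singleton_iff.1 hy'] at hz
  exact hrt (hr' _ _ hz)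

theorem exists_radius_of_cof_lt (hne : E.radii.Nonempty) (h : E.cof < ℵ₀) :
    ∃ ε ∈ E.radii, ∀ x y, (x, y) ∈ ε := by
  obtain ⟨B, hB, hc⟩ := E.exists_isBase_mk_eq_cof
  have hfin : B.Finite := by
    rw [← Cardinal.lt_aleph0_iff_set_finite, ← hc]; exact h
  have key : ∃ ε ∈ E.radii, ∀ β ∈ B, β ⊆ ε := by
    have : ∀ T : Set (SetRel X X), T.Finite → (∀ β ∈ T, ∃ ε ∈ E.radii, β ⊆ ε) →
        ∃ ε ∈ E.radii, ∀ β ∈ T, β ⊆ ε := by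
      intro T hT
      induction T, hT using Set.Finite.induction_on with
      | empty => exact fun _ => ⟨hne.some, hne.some_mem, by simp⟩
      | @insert a T _ _ ih =>
        intro hT
        obtain ⟨ε, hε, h⟩ := ih fun β hβ => hT β (Set.mem_insert_of_mem _ hβ)
        obtain ⟨δ, hδ, h'⟩ := hT a (Set.mem_insert _ _)
        obtain ⟨η, hη, h1, h2⟩ := E.exists_radius_union hε hδ
        refine ⟨η, hη, fun β hβ => ?_⟩
        rcases hβ with rfl | hβ
        · exact h'.trans h2
        · exact (h β hβ).trans h1
    exact this B hfin fun β hβ => (hB.1 hβ).2.2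
  obtain ⟨ε, hε, h⟩ := key
  refine ⟨ε, hε, fun x y => ?_⟩
  obtain ⟨δ, hδ, hxy⟩ := E.exists_radius_mem x y
  obtain ⟨β, hβ, hδβ⟩ := hB.2 δ (E.radius_mem_coarseStructure hδ)
  exact h β hβ (hδβ hxy)

theorem exists_not_mem_radius (h : ℵ₀ ≤ E.cof) {ε : SetRel X X} (hε : ε ∈ E.radii) :
    ∃ x y, (x, y) ∉ ε := by
  by_contra! hcon
  have hB : E.IsBase {ε} := by
    refine ⟨?_, fun δ _ => ⟨ε, rfl, fun p _ => hcon _ _⟩⟩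
    rintro _ rfl
    exact E.radius_mem_coarseStructure hε
  have h1 := h.trans hB.cof_le
  rw [mk_singleton] at h1
  exact absurd h1 (not_le.2 one_lt_aleph0)

theorem covSharp_le_one_iff (hne : E.radii.Nonempty) : E.covSharp ≤ 1 ↔ IsEmpty X := by
  refine ⟨fun h => ?_, fun h => ?_⟩
  · by_contra hX
    obtain ⟨x⟩ := not_isEmpty_iff.1 hX
    obtain ⟨ε, hε, h'⟩ := E.exists_radius_covSharp hne
    have h1 := (h' ε hε).trans_le h
    have h2 : entCov ε (entBall ε {x}) < 1 :=
      lt_of_le_of_lt (le_ciSup (bddAbove_range_cardinal fun x => entCov ε (entBall ε {x})) x) h1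
    obtain ⟨C, hC, hc⟩ := E.exists_entCov_eq hε (entBall ε {x})
    rw [hc, Cardinal.lt_one_iff, mk_eq_zero_iff] at h2
    obtain ⟨c, hc, -⟩ := hC ⟨x, rfl, E.radius_refl hε x⟩
    exact h2.false ⟨c, hc⟩
  · obtain ⟨ε, hε⟩ := hne
    refine E.covSharp_le hε fun δ _ => lt_of_le_of_lt (b := 0) (ciSup_le' fun x => (h.false x).elim) ?_
    exact (zero_lt_one : (0 : Cardinal) < 1)

/-- If cov♯ were `m + 1`, some small relation would already have `m` classes of `s₀` in each of its
classes. Since no radius is everything, a larger small relation adds one more, which exceeds the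
bound. -/
theorem aleph0_le_covSharp (hne : E.radii.Nonempty) (hH : E.IsHomogeneous) (hE : E.IsCellular)
    (h : ℵ₀ ≤ E.cof) : ℵ₀ ≤ E.covSharp := by
  by_contra! hcon
  obtain ⟨s₀, hs₀, hup⟩ := hE.exists_classCount_le hne
  obtain ⟨m, hm⟩ := lt_aleph0.1 hcon
  obtain ⟨c₀, hc₀, -⟩ := hup s₀ hs₀
  rcases m with _ | m
  · rw [hm] at hc₀
    simp at hc₀
  obtain ⟨t, ht, hst, hlow⟩ := hH.exists_le_classCount hE hs₀ (c := m)
    (by rw [hm]; exact_mod_cast Nat.lt_succ_self m)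
  have ht' := ht
  obtain ⟨ε, hε, htε⟩ := ht'
  obtain ⟨x, y, hxy⟩ := exists_not_mem_radius h hε
  obtain ⟨r, hr, htr, hrxy⟩ := hE.exists_isSmall_apply ht x y
  obtain ⟨c, hc, hup⟩ := hup r hr
  have h1 : classCount s₀ {z | t x z} + 1 ≤ classCount s₀ {z | r x z} := by
    have hnot : Quotient.mk s₀ y ∉ Quotient.mk s₀ '' {z | t x z} := by
      rintro ⟨z, hz, hzy⟩
      exact hxy (htε _ _ (t.trans' hz (hst (Quotient.exact hzy))))
    rw [classCount, ← mk_insert hnot]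
    refine mk_le_mk_of_subset ?_
    rintro _ (rfl | ⟨z, hz, rfl⟩)
    · exact ⟨y, hrxy, rfl⟩
    · exact ⟨z, htr hz, rfl⟩
  have h2 : (m : Cardinal.{u}) + 1 < E.covSharp :=
    lt_of_le_of_lt (((add_le_add_left (hlow x) 1).trans h1).trans (hup x)) hc
  rw [hm] at h2
  push_cast at h2
  exact lt_irrefl _ h2

/-- If cof were uncountable, the join of countably many small relations with counts at least 0, 1,
2, … would be small, yet have no finite bound. -/
theorem cof_eq_aleph0 (hne : E.radii.Nonempty) (hH : E.IsHomogeneous) (hE : E.IsCellular)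
    (hO : E.IsOrdinal) (h : ℵ₀ ≤ E.cof) (h' : E.covSharp ≤ ℵ₀) : E.cof = ℵ₀ := by
  refine le_antisymm ?_ h
  by_contra! hcon
  have hcov : E.covSharp = ℵ₀ := le_antisymm h' (aleph0_le_covSharp hne hH hE h)
  obtain ⟨s₀, hs₀, hup⟩ := hE.exists_classCount_le hne
  have hlow : ∀ n : ℕ, ∃ t, E.IsSmall t ∧ s₀ ≤ t ∧ ∀ x, (n : Cardinal) ≤ classCount s₀ {y | t x y} :=
    fun n => hH.exists_le_classCount hE hs₀ (by rw [hcov]; exact natCast_lt_aleph0)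
  choose t ht _ hlow using hlow
  have hsm := hE.isSmall_iSup hO (fun n : ULift.{u} ℕ => t n.down) (fun n => ht _) (by simpa using hcon)
  obtain ⟨c, hc, hup⟩ := hup _ hsm
  rw [hcov] at hc
  obtain ⟨n, rfl⟩ := lt_aleph0.1 hc
  obtain ⟨ε, hε⟩ := hne
  obtain ⟨x, -⟩ := exists_not_mem_radius h hε
  have h1 := (hlow (n + 1) x).trans ((classCount_mono _ fun y hy => ?_).trans (hup x))
  · exact absurd (Nat.cast_le.1 h1) (by omega)
  · exact le_iSup (fun n : ULift.{u} ℕ => t n.down) ⟨n + 1⟩ hy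

end Ballean

/-! ### Uniform splitting and coordinates for towers -/

/-- `ℓ` enumerates the `s`-classes inside every `e`-class by the elements of `C`. -/
def IsLabelling {X C : Type u} (s e : Setoid X) (ℓ : X → C) : Prop :=
  (∀ x y, e x y → (s x y ↔ ℓ x = ℓ y)) ∧ ∀ x a, ∃ y, e x y ∧ ℓ y = a

theorem exists_isLabelling {X C : Type u} {s e : Setoid X} (hC : Nonempty C)
    (h : ∀ x, classCount s {y | e x y} = #C) : ∃ ℓ : X → C, IsLabelling s e ℓ := by
  have h1 : ∀ x, ∃ θ : Quotient s → C, Set.BijOn θ (Quotient.mk s '' {y | e x y}) Set.univ := by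
    intro x
    have h2 : #(Quotient.mk s '' {y | e x y}) = #(Set.univ : Set C) := (h x).trans mk_univ.symm
    obtain ⟨g⟩ := Cardinal.eq.1 h2
    classical
    refine ⟨fun q => if hq : q ∈ Quotient.mk s '' {y | e x y} then g ⟨q, hq⟩ else hC.some,
      fun _ _ => trivial, fun q hq q' hq' hqq => ?_, fun c _ => ?_⟩
    · simp only [dif_pos hq, dif_pos hq'] at hqq
      exact congrArg Subtype.val (g.injective (Subtype.ext hqq))
    · refine ⟨g.symm ⟨c, trivial⟩, (g.symm ⟨c, trivial⟩).2, ?_⟩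
      simp
  choose θ hθ using h1
  have hmem : ∀ x, Quotient.mk s x ∈ Quotient.mk s '' {y | e (Quotient.mk e x).out y} :=
    fun x => ⟨x, Quotient.mk_out (s := e) x, rfl⟩
  -- The bijection is taken at the chosen representative of the `e`-class, so that equivalent points
  -- are labelled by one and the same bijection.
  refine ⟨fun x => θ (Quotient.mk e x).out (Quotient.mk s x), fun x y hxy => ?_, fun x a => ?_⟩
  · have hq : Quotient.mk e x = Quotient.mk e y := Quotient.sound hxy
    dsimp only
    rw [hq]
    refine ⟨fun h => by rw [show Quotient.mk s x = Quotient.mk s y from Quotient.sound h],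
      fun h => Quotient.exact ((hθ _).2.1 (hq ▸ hmem x) (hmem y) h)⟩
  · obtain ⟨_, ⟨y, hy, rfl⟩, ha⟩ := (hθ (Quotient.mk e x).out).2.2 (Set.mem_univ a)
    have hxy : e x y := e.trans' (e.symm' (Quotient.mk_out (s := e) x)) hy
    refine ⟨y, hxy, ?_⟩
    dsimp only
    rw [show Quotient.mk e y = Quotient.mk e x from Quotient.sound (e.symm' hxy)]
    exact ha

/-- Each `t`-class has at least `#C` classes of `r`, and `κ = κ * #C` for such infinite `κ`. These
classes can therefore be grouped into bundles of `#C`. A bundle has at least `#C` classes of `s`,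
and at most `#C * #C = #C`. -/
theorem exists_setoid_isLabelling {X C : Type u} {s r t : Setoid X} (hsr : s ≤ r) (hrt : r ≤ t)
    (hC : ℵ₀ ≤ #C) (hs : ∀ x, classCount s {y | r x y} ≤ #C)
    (hr : ∀ x, #C ≤ classCount r {y | t x y}) :
    ∃ (e : Setoid X) (ℓ : X → C), r ≤ e ∧ e ≤ t ∧ IsLabelling s e ℓ := by
  have hCne : Nonempty C := (Cardinal.infinite_iff.2 hC).nonempty
  let π : Quotient r → Quotient t := Quotient.map' id hrt
  have hφ : ∀ q : Quotient t, Nonempty ({p // π p = q} ≃ {p // π p = q} × C) := by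
    intro q
    rw [← Cardinal.eq, mk_prod, lift_id, lift_id]
    have h1 : #C ≤ #{p // π p = q} := by
      refine (hr q.out).trans (mk_le_mk_of_subset ?_)
      rintro _ ⟨y, hy, rfl⟩
      change Quotient.mk t y = q
      rw [← Quotient.out_eq q]
      exact Quotient.sound (t.symm' hy)
    exact (mul_eq_left (hC.trans h1) h1 (aleph0_pos.trans_le hC).ne').symm
  let φ := fun q => (hφ q).some
  -- The fibrewise bijections are glued over the quotient by `t`. The first component of `ψ` names
  -- the bundle, the second the place within it.
  let ψ : Quotient r ≃ Quotient r × C :=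
    (Equiv.sigmaFiberEquiv π).symm.trans ((Equiv.sigmaCongrRight φ).trans
      ((Equiv.sigmaProdDistrib _ _).symm.trans ((Equiv.sigmaFiberEquiv π).prodCongr (Equiv.refl C))))
  have hψ : ∀ p, π (ψ p).1 = π p := by
    intro p
    exact ((φ (π p)) ⟨p, rfl⟩).1.2
  let e : Setoid X := Setoid.ker fun x => (ψ (Quotient.mk r x)).1
  have hre : r ≤ e := fun x y hxy => by
    change (ψ (Quotient.mk r x)).1 = (ψ (Quotient.mk r y)).1
    rw [show Quotient.mk r x = Quotient.mk r y from Quotient.sound hxy]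
  have het : e ≤ t := fun x y hxy => by
    have h : (ψ (Quotient.mk r x)).1 = (ψ (Quotient.mk r y)).1 := hxy
    have h2 : π (Quotient.mk r x) = π (Quotient.mk r y) := by rw [← hψ, h, hψ]
    exact Quotient.exact h2
  obtain ⟨ℓ, hℓ⟩ := exists_isLabelling (C := C) hCne (fun x => by
    apply le_antisymm
    · let g : C → X := fun c => (ψ.symm ((ψ (Quotient.mk r x)).1, c)).out
      have hsub : Quotient.mk s '' {y | e x y} ⊆ ⋃ c, Quotient.mk s '' {y | r (g c) y} := by
        rintro _ ⟨y, hy, rfl⟩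
        refine Set.mem_iUnion.2 ⟨(ψ (Quotient.mk r y)).2, y, ?_, rfl⟩
        have h : (ψ (Quotient.mk r x)).1 = (ψ (Quotient.mk r y)).1 := hy
        change r (g _) y
        simp only [g, h, Prod.mk.eta, Equiv.symm_apply_apply]
        exact Quotient.mk_out (s := r) y
      refine (mk_le_mk_of_subset hsub).trans ((mk_iUnion_le _).trans ?_)
      refine (mul_le_mul' le_rfl (ciSup_le' fun c => hs (g c))).trans ?_
      rw [mul_eq_self hC]
    · let T : Quotient s → C := fun q => (ψ (Quotient.map' id hsr q)).2
      refine (mk_univ (α := C)).symm.le.trans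
        ((mk_le_mk_of_subset (t := T '' (Quotient.mk s '' {y | e x y})) ?_).trans mk_image_le)
      intro c _
      obtain ⟨y, hy⟩ := Quotient.exists_rep (ψ.symm ((ψ (Quotient.mk r x)).1, c))
      have h3 : ψ (Quotient.mk r y) = ((ψ (Quotient.mk r x)).1, c) := by
        rw [hy, Equiv.apply_symm_apply]
      refine ⟨_, ⟨y, ?_, rfl⟩, ?_⟩
      · change (ψ (Quotient.mk r x)).1 = (ψ (Quotient.mk r y)).1
        rw [h3]
      · change (ψ (Quotient.mk r y)).2 = c
        rw [h3])
  exact ⟨e, ℓ, hre, het, hℓ⟩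

/-- The join of `s₀` with the equivalence relations of index below `i`. -/
def lowerJoin {X I : Type u} [LinearOrder I] (s₀ : Setoid X) (e : I → Setoid X) (i : I) :
    Setoid X :=
  s₀ ⊔ ⨆ j : Set.Iio i, e j

/-- The relations form a chain above `s₀`, so their union is already transitive and the join is that
union. -/
theorem lowerJoin_apply {X I : Type u} [LinearOrder I] {s₀ : Setoid X} {e : I → Setoid X}
    (h : ∀ i, lowerJoin s₀ e i ≤ e i) {i : I} {x y : X} (hxy : lowerJoin s₀ e i x y) :
    s₀ x y ∨ ∃ j < i, e j x y := by
  have h0 : ∀ j, s₀ ≤ e j := fun j => le_sup_left.trans (h j)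
  have hmono : Monotone e := by
    intro j k hjk
    rcases hjk.eq_or_lt with rfl | hlt
    · exact le_rfl
    · exact ((le_iSup (fun j : Set.Iio k => e j) ⟨j, hlt⟩).trans le_sup_right).trans (h k)
  let t : Setoid X := ⟨fun x y => s₀ x y ∨ ∃ j < i, e j x y, fun x => Or.inl (s₀.refl' x), by
    rintro x y (h | ⟨j, hj, h⟩)
    · exact Or.inl (s₀.symm' h)
    · exact Or.inr ⟨j, hj, (e j).symm' h⟩, by
    rintro x y z (h | ⟨j, hj, h⟩) (h' | ⟨k, hk, h'⟩)
    · exact Or.inl (s₀.trans' h h')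
    · exact Or.inr ⟨k, hk, (e k).trans' (h0 k h) h'⟩
    · exact Or.inr ⟨j, hj, (e j).trans' h (h0 j h')⟩
    · exact Or.inr ⟨max j k, max_lt hj hk,
        (e _).trans' (hmono (le_max_left j k) h) (hmono (le_max_right j k) h')⟩⟩
  have hle : lowerJoin s₀ e i ≤ t :=
    sup_le (fun x y h => Or.inl h) (iSup_le fun j x y h => Or.inr ⟨j, j.2, h⟩)
  exact hle hxy

/-- Coordinates for a tower of equivalence relations all of whose classes split uniformly. -/
theorem exists_coordinates {X I : Type u} [LinearOrder I] [WellFoundedLT I] [Nonempty X]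
    {s₀ : Setoid X} {e : I → Setoid X} (h : ∀ i, lowerJoin s₀ e i ≤ e i)
    (htop : ∀ x y, ∃ i, e i x y) {C : I → Type u} (z : ∀ i, C i) (ℓ : ∀ i, X → C i)
    (hℓ : ∀ i, IsLabelling (lowerJoin s₀ e i) (e i) (ℓ i)) :
    ∃ L : X → ∀ i, C i, (∀ i x y, e i x y ↔ ∀ j, i < j → L x j = L y j) ∧
      (∀ x y, L x = L y → s₀ x y) ∧ Set.range L = {v | {i | v i ≠ z i}.Finite} := by
  classical
  obtain ⟨_, hwo⟩ := exists_wellFoundedLT X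
  have hlow : ∀ i j, i < j → e i ≤ lowerJoin s₀ e j := fun i j hij =>
    (le_iSup (fun j : Set.Iio j => e j) ⟨i, hij⟩).trans le_sup_right
  have hmono : ∀ i j, i < j → e i ≤ e j := fun i j hij => (hlow i j hij).trans (h j)
  have hmin : ∀ (s : Setoid X) (x : X), ∃ m, s x m ∧ ∀ y, s x y → m ≤ y := by
    intro s x
    obtain ⟨m, hm, hm'⟩ := WellFounded.has_min hwo.wf {y | s x y} ⟨x, s.refl' x⟩
    exact ⟨m, hm, fun y hy => not_lt.1 (hm' y hy)⟩
  choose m hm hm' using hmin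
  have hmeq : ∀ (s : Setoid X) x y, s x y → m s x = m s y := fun s x y hxy =>
    le_antisymm (hm' _ _ _ (s.trans' hxy (hm s y))) (hm' _ _ _ (s.trans' (s.symm' hxy) (hm s x)))
  -- The base point of a class is its least element in a well-order of `X`. The swap normalizes the
  -- labels so that the base point of each `e i`-class gets the label `z i`.
  let L : X → ∀ i, C i := fun x i => Equiv.swap (ℓ i (m (e i) x)) (z i) (ℓ i x)
  have hL1 : ∀ i x y, e i x y → (lowerJoin s₀ e i x y ↔ L x i = L y i) := by
    intro i x y hxy
    simp only [L, hmeq (e i) x y hxy, (Equiv.injective _).eq_iff]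
    exact (hℓ i).1 x y hxy
  have hL2 : ∀ i x a, ∃ y, e i x y ∧ L y i = a := by
    intro i x a
    obtain ⟨y, hxy, hy⟩ := (hℓ i).2 x (Equiv.swap (ℓ i (m (e i) x)) (z i) a)
    refine ⟨y, hxy, ?_⟩
    simp only [L, ← hmeq (e i) x y hxy, hy, Equiv.swap_apply_self]
  have hL3 : ∀ i x, m (e i) x = x → L x i = z i := by
    intro i x hx
    simp only [L, hx, Equiv.swap_apply_left]
  have hL4 : ∀ i x, L x i ≠ z i → m (e i) x < m (lowerJoin s₀ e i) x := by
    intro i x hx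
    refine lt_of_le_of_ne (hm' _ _ _ (h i (hm _ x))) fun heq => hx ?_
    have h1 : lowerJoin s₀ e i x (m (e i) x) := by rw [heq]; exact hm _ x
    rw [(hL1 i x _ (hm (e i) x)).1 h1]
    exact hL3 _ _ (hmeq (e i) _ _ (hm (e i) x)).symm
  have hfin : ∀ x, {i | L x i ≠ z i}.Finite := by
    intro x
    -- At each index of the support the base point of the class of `x` strictly decreases. An
    -- infinite support would thus be well-ordered in both directions.
    have hanti : ∀ i j, L x j ≠ z j → i < j → m (e j) x < m (e i) x := fun i j hj hij =>
      (hL4 j x hj).trans_le (hm' _ _ _ (hlow i j hij (hm _ x)))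
    by_contra hinf
    have hinf' : Infinite {i | L x i ≠ z i} := Set.infinite_coe_iff.2 hinf
    have hgt : WellFoundedGT {i | L x i ≠ z i} := by
      have hw : WellFounded (InvImage (· < ·) fun i : {i | L x i ≠ z i} => m (e i) x) :=
        InvImage.wf _ hwo.wf
      refine ⟨Subrelation.wf (r := InvImage (· < ·) fun i : {i | L x i ≠ z i} => m (e i) x)
        (fun {a b} hab => ?_) hw⟩
      exact hanti b a a.2 hab
    exact not_finite_iff_infinite.2 hinf' (Finite.of_wellFoundedLT_wellFoundedGT _)
  have hstep : ∀ i x y, e i x y → ∀ j, i < j → L x j = L y j := fun i x y hxy j hij =>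
    (hL1 j x y (hmono i j hij hxy)).1 (hlow i j hij hxy)
  refine ⟨L, fun i x y => ⟨hstep i x y, fun hxy => ?_⟩, fun x y hxy => ?_, ?_⟩
  · obtain ⟨k, hk, hk'⟩ := WellFounded.has_min (wellFounded_lt (α := I)) {k | e k x y} (htop x y)
    by_cases hik : i < k
    · rcases lowerJoin_apply h ((hL1 k x y hk).2 (hxy k hik)) with h0 | ⟨j, hj, hjxy⟩
      · exact (le_sup_left.trans (h i) : s₀ ≤ e i) h0
      · exact absurd hj (hk' j hjxy)
    · rcases (not_lt.1 hik).eq_or_lt with rfl | hlt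
      · exact hk
      · exact hmono k i hlt hk
  · obtain ⟨k, hk, hk'⟩ := WellFounded.has_min (wellFounded_lt (α := I)) {k | e k x y} (htop x y)
    rcases lowerJoin_apply h ((hL1 k x y hk).2 (congrFun hxy k)) with h0 | ⟨j, hj, hjxy⟩
    · exact h0
    · exact absurd hj (hk' j hjxy)
  · refine Set.Subset.antisymm (by rintro _ ⟨x, rfl⟩; exact hfin x) ?_
    have key : ∀ (T : Finset I) (v : ∀ i, C i), (∀ i, i ∉ T → v i = z i) → ∃ x, L x = v := by
      intro T
      -- Prescribing the coordinate `a` may disturb lower coordinates but not higher ones, so the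
      -- smallest index is added last.
      induction T using Finset.induction_on_min with
      | empty =>
        intro v hv
        obtain ⟨x, -, hx⟩ := WellFounded.has_min hwo.wf Set.univ (Set.univ_nonempty (α := X))
        refine ⟨x, funext fun i => ?_⟩
        rw [hv i (Finset.notMem_empty i)]
        exact hL3 i x (le_antisymm (hm' _ _ _ ((e i).refl' x)) (not_lt.1 (hx _ trivial)))
      | insert a T ha ih =>
        intro v hv
        obtain ⟨x, hx⟩ := ih (Function.update v a (z a)) (fun i hi => by
          by_cases hia : i = a
          · subst hia; simp
          · rw [Function.update_of_ne hia]
            exact hv i (by simp [hia, hi]))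
        obtain ⟨y, hxy, hy⟩ := hL2 a x (v a)
        have hyy := hm (lowerJoin s₀ e a) y
        -- Passing to the base point of the lower join resets all coordinates below `a` to `z` and
        -- keeps those from `a` on.
        refine ⟨m (lowerJoin s₀ e a) y, funext fun i => ?_⟩
        rcases lt_trichotomy i a with hia | rfl | hia
        · have hiT : i ∉ insert a T := by
            intro hmem
            rcases Finset.mem_insert.1 hmem with rfl | hmem
            · exact lt_irrefl _ hia
            · exact lt_asymm hia (ha i hmem)
          rw [hv i hiT]
          refine hL3 i _ (le_antisymm (hm' _ _ _ ((e i).refl' _)) ?_)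
          exact hm' _ _ _ ((lowerJoin s₀ e a).trans' hyy (hlow i a hia (hm (e i) _)))
        · rw [← hy]
          exact ((hL1 i y _ (h i hyy)).1 hyy).symm
        · have h1 : e a x (m (lowerJoin s₀ e a) y) := (e a).trans' hxy (h a hyy)
          rw [← hstep a _ _ h1 i hia, hx, Function.update_of_ne hia.ne']
    intro v hv
    exact key (Set.Finite.toFinset hv) v fun i hi => by simpa using hi

/-! ### Matched transfinite towers: the case of uncountable cov♯ -/

namespace Ballean

variable {X Y : Type u} {E : Ballean X} {F : Ballean Y}

theorem IsCellular.isSmall_lowerJoin (hE : E.IsCellular) (hO : E.IsOrdinal) {I : Type u}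
    [LinearOrder I] {s₀ : Setoid X} (hs₀ : E.IsSmall s₀) (e : I → Setoid X) (i : I)
    (hi : #(Set.Iio i) < E.cof) (he : ∀ j < i, E.IsSmall (e j)) :
    E.IsSmall (lowerJoin s₀ e i) :=
  hE.isSmall_sup hs₀ (hE.isSmall_iSup hO _ (fun j => he j j.2) hi)

/-- The threshold `c` comes before `C`, so that one label type can be chosen to serve both balleans.
-/
theorem exists_isSmall_isLabelling (hE : E.IsCellular) (hH : E.IsHomogeneous) {s₀ s b : Setoid X}
    (hup : ∀ s, E.IsSmall s → ∃ c < E.covSharp, ∀ x, classCount s₀ {y | s x y} ≤ c)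
    (hs : E.IsSmall s) (hb : E.IsSmall b) (h₀ : s₀ ≤ s) :
    ∃ c < E.covSharp, ∀ C : Type u, c ≤ #C → ℵ₀ ≤ #C → #C < E.covSharp →
      ∃ (e : Setoid X) (ℓ : X → C), E.IsSmall e ∧ s ≤ e ∧ b ≤ e ∧ IsLabelling s e ℓ := by
  have hr := hE.isSmall_sup hs hb
  obtain ⟨c, hc, hup⟩ := hup _ hr
  refine ⟨c, hc, fun C hcC hC hCE => ?_⟩
  obtain ⟨t, ht, hrt, hlow⟩ := hH.exists_le_classCount hE hr hCE
  obtain ⟨e, ℓ, hre, het, hℓ⟩ := exists_setoid_isLabelling (C := C) le_sup_left hrt hC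
    (fun x => (classCount_anti h₀ _).trans ((hup x).trans hcC)) hlow
  exact ⟨e, ℓ, ht.mono het, le_sup_left.trans hre, le_sup_right.trans hre, hℓ⟩

theorem coarselyEquivalent_of_aleph0_lt (hne : E.radii.Nonempty) (hneF : F.radii.Nonempty)
    (hE : E.IsCellular) (hEO : E.IsOrdinal) (hEH : E.IsHomogeneous)
    (hF : F.IsCellular) (hFO : F.IsOrdinal) (hFH : F.IsHomogeneous)
    [Nonempty X] [Nonempty Y]
    (hcof : E.cof = F.cof) (hcov : E.covSharp = F.covSharp) (hlt : ℵ₀ < E.covSharp) :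
    E.CoarselyEquivalent F := by
  obtain ⟨s₀, hs₀, hsup⟩ := hE.exists_classCount_le hne
  obtain ⟨t₀, ht₀, htup⟩ := hF.exists_classCount_le hneF
  let I := E.cof.ord.ToType
  obtain ⟨b, hb, hb'⟩ := hE.exists_cofinal (ι := I) (by simp [I])
  obtain ⟨d, hd, hd'⟩ := hF.exists_cofinal (ι := I) (by simp [I, hcof])
  have hstep : ∀ (i : I) (s : Setoid X) (t : Setoid Y), ∃ p : Setoid X × Setoid Y × Type u,
      E.IsSmall s → F.IsSmall t → s₀ ≤ s → t₀ ≤ t →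
        (E.IsSmall p.1 ∧ s ≤ p.1 ∧ b i ≤ p.1) ∧ (F.IsSmall p.2.1 ∧ t ≤ p.2.1 ∧ d i ≤ p.2.1) ∧
          Nonempty p.2.2 ∧ (∃ ℓ : X → p.2.2, IsLabelling s p.1 ℓ) ∧
            ∃ ℓ : Y → p.2.2, IsLabelling t p.2.1 ℓ := by
    intro i s t
    by_cases hst : E.IsSmall s ∧ F.IsSmall t ∧ s₀ ≤ s ∧ t₀ ≤ t
    · obtain ⟨hs, ht, hss, htt⟩ := hst
      obtain ⟨c, hc, h1⟩ := exists_isSmall_isLabelling hE hEH hsup hs (hb i) hss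
      obtain ⟨c', hc', h2⟩ := exists_isSmall_isLabelling hF hFH htup ht (hd i) htt
      have hm : #(max (max c c') ℵ₀).out = max (max c c') ℵ₀ := mk_out _
      have hlt' : max (max c c') ℵ₀ < E.covSharp := max_lt (max_lt hc (hcov ▸ hc')) hlt
      obtain ⟨e, ℓ, h3, h4, h5, h6⟩ := h1 (max (max c c') ℵ₀).out
        (by rw [hm]; exact (le_max_left _ _).trans (le_max_left _ _))
        (by rw [hm]; exact le_max_right _ _) (by rwa [hm])
      obtain ⟨e', ℓ', h3', h4', h5', h6'⟩ := h2 (max (max c c') ℵ₀).out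
        (by rw [hm]; exact (le_max_right _ _).trans (le_max_left _ _))
        (by rw [hm]; exact le_max_right _ _) (by rwa [hm, ← hcov])
      exact ⟨(e, e', _), fun _ _ _ _ => ⟨⟨h3, h4, h5⟩, ⟨h3', h4', h5'⟩,
        ⟨ℓ (Classical.arbitrary X)⟩, ⟨ℓ, h6⟩, ℓ', h6'⟩⟩
    -- A junk value makes the step total, so that the recursion can be run before smallness of its
    -- terms is known.
    · exact ⟨(⊥, ⊥, PUnit), fun h1 h2 h3 h4 => absurd ⟨h1, h2, h3, h4⟩ hst⟩
  choose P hP using hstep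
  let p : I → Setoid X × Setoid Y × Type u := (wellFounded_lt (α := I)).fix fun i rec =>
    P i (s₀ ⊔ ⨆ j : Set.Iio i, (rec j j.2).1) (t₀ ⊔ ⨆ j : Set.Iio i, (rec j j.2).2.1)
  let e : I → Setoid X := fun i => (p i).1
  let g : I → Setoid Y := fun i => (p i).2.1
  have hp : ∀ i, p i = P i (lowerJoin s₀ e i) (lowerJoin t₀ g i) := fun i =>
    (wellFounded_lt (α := I)).fix_eq _ i
  have hIio : ∀ i : I, #(Set.Iio i) < E.cof := fun i => (mk_Iio_lt i (by simp [I])).trans_eq (by simp [I])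
  have hall : ∀ i, E.IsSmall (e i) ∧ F.IsSmall (g i) := by
    intro i
    induction i using WellFoundedLT.induction with
    | ind i ih =>
      have h1 := hE.isSmall_lowerJoin hEO hs₀ e i (hIio i) fun j hj => (ih j hj).1
      have h2 := hF.isSmall_lowerJoin hFO ht₀ g i (hcof ▸ hIio i) fun j hj => (ih j hj).2
      have h3 := hP i _ _ h1 h2 le_sup_left le_sup_left
      rw [← hp i] at h3
      exact ⟨h3.1.1, h3.2.1.1⟩
  have hall2 : ∀ i, (lowerJoin s₀ e i ≤ e i ∧ b i ≤ e i) ∧ (lowerJoin t₀ g i ≤ g i ∧ d i ≤ g i) ∧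
      Nonempty (p i).2.2 ∧ (∃ ℓ : X → (p i).2.2, IsLabelling (lowerJoin s₀ e i) (e i) ℓ) ∧
        ∃ ℓ : Y → (p i).2.2, IsLabelling (lowerJoin t₀ g i) (g i) ℓ := by
    intro i
    have h1 := hE.isSmall_lowerJoin hEO hs₀ e i (hIio i) fun j _ => (hall j).1
    have h2 := hF.isSmall_lowerJoin hFO ht₀ g i (hcof ▸ hIio i) fun j _ => (hall j).2
    have h3 := hP i _ _ h1 h2 le_sup_left le_sup_left
    rw [← hp i] at h3
    exact ⟨h3.1.2, h3.2.1.2, h3.2.2⟩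
  choose he hg hz hℓX hℓY using hall2
  choose ℓX hℓX using hℓX
  choose ℓY hℓY using hℓY
  let z : ∀ i, (p i).2.2 := fun i => (hz i).some
  obtain ⟨L, hL, hL0, hLr⟩ := exists_coordinates (fun i => (he i).1) (fun x y => by
    obtain ⟨ε, hε, h⟩ := E.exists_radius_mem x y
    obtain ⟨i, hi⟩ := hb' ε hε
    exact ⟨i, (he i).2 (hi _ _ h)⟩) z ℓX hℓX
  obtain ⟨M, hM, hM0, hMr⟩ := exists_coordinates (fun i => (hg i).1) (fun x y => by
    obtain ⟨ε, hε, h⟩ := F.exists_radius_mem x y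
    obtain ⟨i, hi⟩ := hd' ε hε
    exact ⟨i, (hg i).2 (hi _ _ h)⟩) z ℓY hℓY
  -- Both coordinate maps have the same range, as the label types and the base labels `z` are
  -- shared.
  have hf : ∀ x, ∃ y, M y = L x := fun x => by
    have : L x ∈ Set.range M := by rw [hMr, ← hLr]; exact ⟨x, rfl⟩
    exact this
  choose f hf using hf
  have hef : ∀ i x x', e i x x' ↔ g i (f x) (f x') := by
    intro i x x'
    rw [hL, hM, hf, hf]
  refine IsCoarseEmbedding.coarselyEquivalent (f := f) ⟨fun ε hε => ?_, fun δ hδ => ?_⟩ ?_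
  · obtain ⟨i, hi⟩ := hb' ε hε
    obtain ⟨δ, hδ, h⟩ := (hall i).2
    exact ⟨δ, hδ, fun x x' hx => h _ _ ((hef i x x').1 ((he i).2 (hi _ _ hx)))⟩
  · obtain ⟨i, hi⟩ := hd' δ hδ
    obtain ⟨ε, hε, h⟩ := (hall i).1
    exact ⟨ε, hε, fun x x' hx => h _ _ ((hef i x x').2 ((hg i).2 (hi _ _ hx)))⟩
  · obtain ⟨δ, hδ, h⟩ := ht₀
    refine ⟨δ, hδ, fun y => ?_⟩
    have : M y ∈ Set.range L := by rw [hLr, ← hMr]; exact ⟨y, rfl⟩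
    obtain ⟨x, hx⟩ := this
    exact ⟨x, h _ _ (hM0 _ _ ((hf x).trans hx))⟩

end Ballean

/-! ### Interleaving of cut sequences in ℕ -/

/-- The index of the last term of the sequence `σ` that does not exceed `p`. -/
def lastIndex (σ : ℕ → ℕ) (p : ℕ) : ℕ := Nat.findGreatest (fun i => σ i ≤ p) p

theorem le_lastIndex_iff {σ : ℕ → ℕ} (hσ : StrictMono σ) (h0 : σ 0 = 0) {i p : ℕ} :
    i ≤ lastIndex σ p ↔ σ i ≤ p := by
  constructor
  · intro h
    have h1 : σ (lastIndex σ p) ≤ p :=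
      Nat.findGreatest_spec (P := fun i => σ i ≤ p) (Nat.zero_le p) (by simp [h0])
    exact (hσ.monotone h).trans h1
  · intro h
    exact Nat.le_findGreatest ((hσ.le_apply).trans h) h

theorem apply_lastIndex_le {σ : ℕ → ℕ} (hσ : StrictMono σ) (h0 : σ 0 = 0) (p : ℕ) :
    σ (lastIndex σ p) ≤ p :=
  (le_lastIndex_iff hσ h0).1 le_rfl

theorem lt_apply_lastIndex_add_one {σ : ℕ → ℕ} (hσ : StrictMono σ) (h0 : σ 0 = 0) (p : ℕ) :
    p < σ (lastIndex σ p + 1) := by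
  by_contra! h
  have := (le_lastIndex_iff hσ h0).2 h
  omega

theorem lastIndex_eq {σ : ℕ → ℕ} (hσ : StrictMono σ) (h0 : σ 0 = 0) {i p : ℕ} (h1 : σ i ≤ p)
    (h2 : p < σ (i + 1)) : lastIndex σ p = i := by
  refine le_antisymm ?_ ((le_lastIndex_iff hσ h0).2 h1)
  by_contra! h
  have := (le_lastIndex_iff hσ h0 (i := i + 1) (p := p)).1 h
  omega

theorem lastIndex_apply {σ : ℕ → ℕ} (hσ : StrictMono σ) (h0 : σ 0 = 0) (i : ℕ) :
    lastIndex σ (σ i) = i :=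
  lastIndex_eq hσ h0 le_rfl (hσ (Nat.lt_succ_self i))

/-- `lastIndex σ` is the upper adjoint of `σ`, and adjoints compose in reverse order. -/
theorem lastIndex_comp {σ τ : ℕ → ℕ} (hσ : StrictMono σ) (h0 : σ 0 = 0) (hτ : StrictMono τ)
    (h0' : τ 0 = 0) (p : ℕ) : lastIndex (σ ∘ τ) p = lastIndex τ (lastIndex σ p) := by
  refine eq_of_forall_le_iff fun i => ?_
  rw [le_lastIndex_iff (hσ.comp hτ) (by simp [h0, h0']), le_lastIndex_iff hτ h0',
    le_lastIndex_iff hσ h0]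
  rfl

/-- Each `u j` is rounded up to the next term of `Γ`; terms of `Γ` stay fixed. -/
theorem exists_discretization {Γ : ℕ → ℕ} (hΓ : StrictMono Γ) (h0 : Γ 0 = 0) {M : ℕ}
    (hM : ∀ i, Γ (i + 1) ≤ Γ i + M) {u : ℕ → ℝ} (hu : ∀ j, 0 ≤ u j) :
    ∃ τ : ℕ → ℕ, ∀ j, u j ≤ Γ (τ j) ∧ (Γ (τ j) : ℝ) ≤ u j + M ∧ ∀ l, u j = Γ l → τ j = l := by
  classical
  have hex : ∀ j, ∃ l, u j ≤ Γ l := fun j => by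
    obtain ⟨n, hn⟩ := exists_nat_ge (u j)
    exact ⟨n, hn.trans (by exact_mod_cast hΓ.le_apply)⟩
  refine ⟨fun j => Nat.find (hex j), fun j => ⟨Nat.find_spec (hex j), ?_, fun l hl => ?_⟩⟩
  · rcases Nat.eq_zero_or_pos (Nat.find (hex j)) with h | h
    · dsimp only
      rw [h, h0]
      simpa using add_nonneg (hu j) (Nat.cast_nonneg M)
    · obtain ⟨n, hn⟩ := Nat.exists_eq_succ_of_ne_zero h.ne'
      have h1 : ¬ u j ≤ Γ n := Nat.find_min (hex j) (by omega)
      have h2 : (Γ (n + 1) : ℝ) ≤ Γ n + M := by exact_mod_cast hM n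
      dsimp only
      rw [hn, Nat.succ_eq_add_one]
      linarith
  · refine (Nat.find_eq_iff (hex j)).2 ⟨hl.le, fun n hn => ?_⟩
    rw [hl, not_le]
    exact_mod_cast hΓ hn

/-- `u` is affine in `A` between consecutive indices `τ i`. Its slopes are the quotients of the
steps of `B` and `A ∘ τ`, which the hypotheses keep between `1 / ρ` and `ρ`. -/
theorem exists_interpolation {τ : ℕ → ℕ} (hτ : StrictMono τ) (h0 : τ 0 = 0) {A B : ℕ → ℝ}
    (hA : StrictMono A) {ρ : ℝ}
    (h1 : ∀ i, B (i + 1) - B i ≤ ρ * (A (τ (i + 1)) - A (τ i)))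
    (h2 : ∀ i, A (τ (i + 1)) - A (τ i) ≤ ρ * (B (i + 1) - B i)) :
    ∃ u : ℕ → ℝ, (∀ i, u (τ i) = B i) ∧ ∀ j, u (j + 1) - u j ≤ ρ * (A (j + 1) - A j) ∧
      A (j + 1) - A j ≤ ρ * (u (j + 1) - u j) := by
  let s : ℕ → ℝ := fun i => (B (i + 1) - B i) / (A (τ (i + 1)) - A (τ i))
  have hpos : ∀ i, 0 < A (τ (i + 1)) - A (τ i) := fun i =>
    sub_pos.2 (hA (hτ (Nat.lt_succ_self i)))
  let u : ℕ → ℝ := fun j => B (lastIndex τ j) + s (lastIndex τ j) * (A j - A (τ (lastIndex τ j)))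
  have hu : ∀ i, u (τ i) = B i := fun i => by
    simp only [u, lastIndex_apply hτ h0]
    ring
  refine ⟨u, hu, fun j => ?_⟩
  have hdiff : u (j + 1) - u j = s (lastIndex τ j) * (A (j + 1) - A j) := by
    set i := lastIndex τ j with hi
    have hle := apply_lastIndex_le hτ h0 j
    have hlt := lt_apply_lastIndex_add_one hτ h0 j
    rw [← hi] at hle hlt
    have huj : u j = B i + s i * (A j - A (τ i)) := rfl
    have huj' : u (j + 1) = B i + s i * (A (j + 1) - A (τ i)) := by
      rcases Nat.lt_or_ge (j + 1) (τ (i + 1)) with h | h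
      · have : lastIndex τ (j + 1) = i := lastIndex_eq hτ h0 (by omega) h
        simp only [u, this]
      · have h3 : j + 1 = τ (i + 1) := by omega
        rw [h3, hu]
        have := hpos i
        simp only [s]
        field_simp
        ring
    rw [huj, huj']
    ring
  have hw : 0 < A (j + 1) - A j := sub_pos.2 (hA (Nat.lt_succ_self j))
  have hs1 : s (lastIndex τ j) ≤ ρ := (div_le_iff₀ (hpos _)).2 (h1 _)
  have hs2 : 1 ≤ ρ * s (lastIndex τ j) := by
    have := (one_le_div (hpos (lastIndex τ j))).2 (h2 _)
    rwa [mul_div_assoc] at this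
  rw [hdiff]
  constructor
  · exact mul_le_mul_of_nonneg_right hs1 hw.le
  · nlinarith

/-- The steps of the sequences `A ∘ τ` and `B` are comparable with constant `ρ`. -/
def IsBalanced (ρ : ℝ) (A B τ : ℕ → ℕ) : Prop :=
  τ 0 = 0 ∧ ∀ i, (B (i + 1) - B i : ℝ) ≤ ρ * (A (τ (i + 1)) - A (τ i)) ∧
    (A (τ (i + 1)) - A (τ i) : ℝ) ≤ ρ * (B (i + 1) - B i)

theorem IsBalanced.strictMono {ρ : ℝ} {A B τ : ℕ → ℕ} (h : IsBalanced ρ A B τ) (hρ : 0 < ρ)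
    (hA : StrictMono A) (hB : StrictMono B) : StrictMono τ := by
  refine strictMono_nat_of_lt_succ fun i => ?_
  have h1 := (h.2 i).1
  have h2 : (B i : ℝ) < B (i + 1) := by exact_mod_cast hB (Nat.lt_succ_self i)
  have h3 : (0 : ℝ) < A (τ (i + 1)) - A (τ i) := by
    by_contra! hcon
    nlinarith
  have h4 : A (τ i) < A (τ (i + 1)) := by exact_mod_cast sub_pos.1 h3
  exact hA.lt_iff_lt.1 h4

theorem exists_isBalanced {A B : ℕ → ℕ} (hA : StrictMono A) (hA0 : A 0 = 0)
    (hB : StrictMono B) {M k : ℕ} (hM : ∀ i, A (i + 1) ≤ A i + M)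
    (hMB : ∀ i, B i + 2 ^ (k + 3) * M ≤ B (i + 1)) {u : ℕ → ℝ} (hu0 : u 0 = 0)
    (hu : ∀ j, u (j + 1) - u j ≤ (1 + (1 / 2) ^ (k + 1)) * (B (j + 1) - B j) ∧
      (B (j + 1) - B j : ℝ) ≤ (1 + (1 / 2) ^ (k + 1)) * (u (j + 1) - u j)) :
    ∃ τ, IsBalanced (1 + (1 / 2) ^ k) A B τ ∧ ∀ j l, u j = A l → τ j = l := by
  -- In terms of `q`, the given tolerance is `4 * q`, the target is `8 * q`, and the rounding error
  -- `M` is at most `q` times a step of `B`.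
  obtain ⟨q, hq⟩ : ∃ q : ℝ, q = (1 / 2) ^ (k + 3) := ⟨_, rfl⟩
  have hq0 : 0 < q := by rw [hq]; positivity
  have hq1 : q ≤ 1 / 8 := by
    rw [hq, pow_add]
    have : ((1 : ℝ) / 2) ^ k ≤ 1 := pow_le_one₀ (by norm_num) (by norm_num)
    nlinarith
  have hk1 : ((1 : ℝ) / 2) ^ (k + 1) = 4 * q := by rw [hq]; ring
  have hk0 : ((1 : ℝ) / 2) ^ k = 8 * q := by rw [hq]; ring
  rw [hk1] at hu
  rw [hk0]
  have hBpos : ∀ j, (0 : ℝ) < B (j + 1) - B j := fun j =>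
    sub_pos.2 (by exact_mod_cast hB (Nat.lt_succ_self j))
  have hMq : ∀ j, (M : ℝ) ≤ q * (B (j + 1) - B j) := fun j => by
    have h1 : (B j : ℝ) + 2 ^ (k + 3) * M ≤ B (j + 1) := by exact_mod_cast hMB j
    have h2 : q * 2 ^ (k + 3) = 1 := by rw [hq, ← mul_pow]; norm_num
    calc (M : ℝ) = q * (2 ^ (k + 3) * M) := by rw [← mul_assoc, h2, one_mul]
      _ ≤ _ := mul_le_mul_of_nonneg_left (by linarith) hq0.le
  have humono : ∀ j, 0 < u (j + 1) - u j := fun j => by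
    have h1 := (hu j).2
    have h2 := hBpos j
    by_contra! hcon
    nlinarith
  have hunn : ∀ j, 0 ≤ u j := fun j => by
    induction j with
    | zero => exact hu0.ge
    | succ j ih => linarith [humono j]
  obtain ⟨τ, hτ⟩ := exists_discretization hA hA0 hM hunn
  refine ⟨τ, ⟨(hτ 0).2.2 0 (by simp [hu0, hA0]), fun j => ?_⟩, fun j l h => (hτ j).2.2 l h⟩
  have h1 := hτ j
  have h2 := hτ (j + 1)
  have h3 := hu j
  have h4 := hMq j
  have h5 := hBpos j
  have h6 := humono j
  have hM0 : (0 : ℝ) ≤ M := Nat.cast_nonneg M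
  constructor
  · have h7 : u (j + 1) - u j - M ≤ A (τ (j + 1)) - A (τ j) := by linarith
    refine le_trans ?_ (mul_le_mul_of_nonneg_left h7 (by positivity))
    have h8 : (B (j + 1) - B j : ℝ) ≤ 2 * (u (j + 1) - u j) := by nlinarith
    have h9 : (1 + 8 * q) * M ≤ 2 * M := by nlinarith
    nlinarith
  · have h7 : (A (τ (j + 1)) - A (τ j) : ℝ) ≤ u (j + 1) - u j + M := by linarith
    nlinarith

/-- The maps are built downwards from the top level. Given `σ 0` one level up, `Γ (k + 1)` is
deformed so as to pass exactly through `Γ (k + 2)`, then rounded to `Γ k`. Rounding fixes the points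
of `Γ (k + 2)`, which are terms of `Γ k`, and this gives the exact composite. Each level down only
doubles the tolerance. -/
theorem exists_finite_interleaving {Γ : ℕ → ℕ → ℕ} (hΓ : ∀ k, StrictMono (Γ k))
    (h0 : ∀ k, Γ k 0 = 0) (hsub : ∀ k i, ∃ j, Γ (k + 2) i = Γ k j) {M : ℕ → ℕ}
    (hM : ∀ k i, Γ k (i + 1) ≤ Γ k i + M k)
    (hM' : ∀ k i, Γ (k + 1) i + 2 ^ (k + 3) * M k ≤ Γ (k + 1) (i + 1)) (n : ℕ) :
    ∀ k, ∃ σ : ℕ → ℕ → ℕ,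
      (∀ i ≤ n, IsBalanced (1 + (1 / 2) ^ (k + i)) (Γ (k + i)) (Γ (k + i + 1)) (σ i)) ∧
        ∀ i < n, ∀ j, Γ (k + i) (σ i (σ (i + 1) j)) = Γ (k + i + 2) j := by
  induction n with
  | zero =>
    intro k
    obtain ⟨τ, hτ, -⟩ := exists_isBalanced (hΓ k) (h0 k) (hΓ (k + 1)) (hM k) (hM' k)
      (u := fun j => Γ (k + 1) j) (by simp [h0]) (fun j => by
        have h1 : (Γ (k + 1) j : ℝ) < Γ (k + 1) (j + 1) := by
          exact_mod_cast hΓ (k + 1) (Nat.lt_succ_self j)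
        have h2 : (0 : ℝ) < (1 / 2) ^ (k + 1) := by positivity
        constructor <;> nlinarith)
    refine ⟨fun _ => τ, fun i hi => ?_, fun i hi => absurd hi (by omega)⟩
    obtain rfl : i = 0 := by omega
    exact hτ
  | succ n ih =>
    intro k
    obtain ⟨σ, h1, h2⟩ := ih (k + 1)
    have hb := h1 0 (Nat.zero_le n)
    have hmono := hb.strictMono (by positivity) (hΓ _) (hΓ _)
    obtain ⟨u, hu, hu'⟩ := exists_interpolation hmono hb.1
      (A := fun j => (Γ (k + 1) j : ℝ)) (B := fun j => (Γ (k + 2) j : ℝ))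
      (fun a b hab => Nat.cast_lt.2 (hΓ (k + 1) hab)) (fun i => (hb.2 i).1) (fun i => (hb.2 i).2)
    obtain ⟨τ, hτ, hτ'⟩ := exists_isBalanced (hΓ k) (h0 k) (hΓ (k + 1)) (hM k) (hM' k) (u := u)
      (by have := hu 0; rw [hb.1, h0] at this; simpa using this) hu'
    refine ⟨fun i => Nat.casesOn i τ σ, fun i hi => ?_, fun i hi j => ?_⟩
    · rcases i with _ | i
      · exact hτ
      · have := h1 i (by omega)
        rw [show k + 1 + i = k + (i + 1) by ring] at this
        exact this
    · rcases i with _ | i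
      · obtain ⟨l, hl⟩ := hsub k j
        have : τ (σ 0 j) = l := hτ' _ _ (by rw [hu, hl])
        change Γ k (τ (σ 0 j)) = Γ (k + 2) j
        rw [this, hl]
      · have := h2 i (by omega) j
        rw [show k + 1 + i = k + (i + 1) by ring] at this
        exact this

theorem exists_eventually_eq_of_le {α : Type*} {U : Ultrafilter α} {f : α → ℕ} {b : ℕ}
    (h : ∀ᶠ a in U, f a ≤ b) : ∃ v, ∀ᶠ a in U, f a = v := by
  have h1 : (⋃ v ∈ Set.Iic b, {a | f a = v}) ∈ U := by
    filter_upwards [h] with a ha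
    exact Set.mem_biUnion (show f a ∈ Set.Iic b from ha) rfl
  obtain ⟨v, -, hv⟩ := (Ultrafilter.finite_biUnion_mem_iff (Set.finite_Iic b)).1 h1
  exact ⟨v, hv⟩

/-- Compactness: the value at `(k, j)` of every sufficiently long finite interleaving is at most `Γ
(k + 2) j`, so values stabilize along an ultrafilter. The conditions retained involve only finitely
many values at a time. -/
theorem exists_interleaving {Γ : ℕ → ℕ → ℕ} (hΓ : ∀ k, StrictMono (Γ k))
    (h0 : ∀ k, Γ k 0 = 0) (hsub : ∀ k i, ∃ j, Γ (k + 2) i = Γ k j) {M : ℕ → ℕ}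
    (hM : ∀ k i, Γ k (i + 1) ≤ Γ k i + M k)
    (hM' : ∀ k i, Γ (k + 1) i + 2 ^ (k + 3) * M k ≤ Γ (k + 1) (i + 1)) :
    ∃ σ : ℕ → ℕ → ℕ, (∀ k, StrictMono (σ k)) ∧ (∀ k, σ k 0 = 0) ∧
      ∀ k j, Γ k (σ k (σ (k + 1) j)) = Γ (k + 2) j := by
  have hfin := fun n => exists_finite_interleaving hΓ h0 hsub hM hM' n 0
  simp only [zero_add] at hfin
  choose S hS hS' using hfin
  let U : Ultrafilter ℕ := Filter.hyperfilter ℕ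
  have hlarge : ∀ k, ∀ᶠ n in (U : Filter ℕ), k < n := fun k =>
    Nat.hyperfilter_le_atTop (Filter.eventually_gt_atTop k)
  have hSmono : ∀ n k, k ≤ n → StrictMono (S n k) := fun n k hk =>
    (hS n k hk).strictMono (by positivity) (hΓ _) (hΓ _)
  have hv : ∀ k j, ∃ v, ∀ᶠ n in (U : Filter ℕ), S n k j = v := fun k j => by
    refine exists_eventually_eq_of_le (b := Γ (k + 2) j) ?_
    filter_upwards [hlarge k] with n hn
    rw [← hS' n k hn j]
    refine ((hΓ k).le_apply).trans' ((hSmono n k hn.le).monotone ?_)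
    exact (hSmono n (k + 1) hn).le_apply
  choose σ hσ using hv
  refine ⟨σ, fun k i j hij => ?_, fun k => ?_, fun k j => ?_⟩
  · obtain ⟨n, h1, h2, h3⟩ := ((hσ k i).and ((hσ k j).and (hlarge k))).exists
    rw [← h1, ← h2]
    exact hSmono n k h3.le hij
  · obtain ⟨n, h1, h2⟩ := ((hσ k 0).and (hlarge k)).exists
    rw [← h1]
    exact (hS n k h2.le).1
  · obtain ⟨n, h1, h2, h3⟩ :=
      ((hσ (k + 1) j).and ((hσ k (σ (k + 1) j)).and (hlarge k))).exists
    rw [← hS' n k h3 j, h1, h2]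

/-! ### Laying out towers with finite classes along ℕ -/

theorem exists_strictMono_range_eq {α : Type*} [LinearOrder α] {R : Set α} (hR : R.Infinite)
    (hfin : ∀ r ∈ R, (R ∩ Set.Iio r).Finite) :
    ∃ h : ℕ → α, StrictMono h ∧ Set.range h = R := by
  let pos : α → ℕ := fun r => (R ∩ Set.Iio r).ncard
  have hpos : ∀ r ∈ R, ∀ r' ∈ R, r < r' → pos r < pos r' := by
    intro r hr r' hr' hlt
    refine Set.ncard_lt_ncard ⟨fun a ha => ⟨ha.1, ha.2.trans hlt⟩, fun hsub => ?_⟩ (hfin r' hr')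
    exact lt_irrefl r (hsub ⟨hr, hlt⟩).2
  have hinj : Set.InjOn pos R := by
    intro r hr r' hr' h
    by_contra hne
    rcases lt_or_gt_of_ne hne with hlt | hlt
    · exact (hpos r hr r' hr' hlt).ne h
    · exact (hpos r' hr' r hr hlt).ne h.symm
  have hsurj : ∀ n, ∃ r ∈ R, pos r = n := by
    intro n
    obtain ⟨_, ⟨r, hr, rfl⟩, hn⟩ := (hR.image hinj).exists_gt n
    have h1 : pos '' (R ∩ Set.Iio r) = Set.Iio (pos r) := by
      refine Set.eq_of_subset_of_ncard_le ?_ ?_ (Set.finite_Iio _)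
      · rintro _ ⟨a, ⟨ha, har⟩, rfl⟩
        exact hpos a ha r hr har
      · rw [(hinj.mono Set.inter_subset_left).ncard_image]
        simp [pos]
    have h2 : n ∈ pos '' (R ∩ Set.Iio r) := h1 ▸ hn
    obtain ⟨a, ha, han⟩ := h2
    exact ⟨a, ha.1, han⟩
  choose h hh hh' using hsurj
  refine ⟨h, fun a b hab => ?_, Set.Subset.antisymm ?_ fun r hr => ⟨pos r, ?_⟩⟩
  · by_contra! hle
    rcases hle.eq_or_lt with heq | hlt
    · have := congrArg pos heq
      rw [hh', hh'] at this
      omega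
    · have := hpos _ (hh b) _ (hh a) hlt
      rw [hh', hh'] at this
      omega
  · rintro _ ⟨n, rfl⟩
    exact hh n
  · exact hinj (hh _) hr (hh' _)

/-- An exhausting tower of equivalence relations with finite classes can be laid out along `ℕ` so
that all classes become intervals. -/
theorem exists_convex_enumeration {X : Type*} {s₀ : Setoid X} {S : ℕ → Setoid X}
    (h0 : s₀ ≤ S 0) (hmono : Monotone S) (htop : ∀ x y, ∃ n, S n x y)
    (hfin : ∀ n x, (Quotient.mk s₀ '' {y | S n x y}).Finite) [Infinite (Quotient s₀)] :
    ∃ g : ℕ → X, (∀ x, ∃ p, s₀ x (g p)) ∧ (∀ p q, s₀ (g p) (g q) → p = q) ∧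
      ∀ n p q r, p ≤ q → q ≤ r → S n (g p) (g r) → S n (g p) (g q) := by
  obtain ⟨x₀⟩ : Nonempty X := (Quotient.out (s := s₀) (Classical.arbitrary _) : X) |> Nonempty.intro
  -- The index shifts by one: `T 0` is `s₀` and `T (n + 1)` is `S n`.
  let T : ℕ → Setoid X := fun n => Nat.casesOn n s₀ S
  have hT : Monotone T := monotone_nat_of_le_succ fun n => by
    rcases n with _ | n
    · exact h0
    · exact hmono (Nat.le_succ n)
  have hcount : ∀ n, Countable (Quotient (T n)) := by
    intro n
    have h1 : Countable (Quotient s₀) := by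
      have h2 : (⋃ n, Quotient.mk s₀ '' {y | S n x₀ y}) = Set.univ := by
        refine Set.eq_univ_of_forall fun q => ?_
        obtain ⟨y, rfl⟩ := Quotient.exists_rep q
        obtain ⟨n, hn⟩ := htop x₀ y
        exact Set.mem_iUnion.2 ⟨n, y, hn, rfl⟩
      rw [← Set.countable_univ_iff, ← h2]
      exact Set.countable_iUnion fun n => (hfin n x₀).countable
    have h3 : Function.Surjective (Quotient.map' id (hT (Nat.zero_le n)) :
        Quotient s₀ → Quotient (T n)) := fun q => by
      obtain ⟨x, rfl⟩ := Quotient.exists_rep q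
      exact ⟨Quotient.mk s₀ x, rfl⟩
    exact h3.countable
  have hlab : ∀ n, ∃ ℓ : X → ℕ, ℓ x₀ = 0 ∧ ∀ x y, T n x y ↔ ℓ x = ℓ y := by
    intro n
    obtain ⟨c, hc⟩ := (hcount n).exists_injective_nat
    refine ⟨fun x => Equiv.swap (c (Quotient.mk _ x₀)) 0 (c (Quotient.mk _ x)), by simp,
      fun x y => ?_⟩
    rw [(Equiv.injective _).eq_iff, hc.eq_iff, Quotient.eq]
  choose ℓ hℓ0 hℓ using hlab
  have hzero : ∀ x, ∃ m, T m x₀ x ∧ ∀ j, m ≤ j → ℓ j x = 0 := by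
    intro x
    obtain ⟨n, hn⟩ := htop x₀ x
    refine ⟨n + 1, hn, fun j hj => ?_⟩
    rw [← hℓ0 j]
    exact ((hℓ j x₀ x).1 (hT hj hn)).symm
  let Λ' : X → (ℕ →₀ ℕ) := fun x => Finsupp.ofSupportFinite (fun i => ℓ i x) (by
    obtain ⟨m, -, hm⟩ := hzero x
    refine (Set.finite_Iio m).subset fun i hi => ?_
    by_contra hcon
    exact hi (hm _ (not_lt.1 hcon)))
  -- Points are compared at the highest index where their labels differ, so the coarsest distinction
  -- decides and classes become convex.
  let Λ : X → Colex (ℕ →₀ ℕ) := fun x => toColex (Λ' x)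
  have hlt : ∀ x y, Λ x < Λ y ↔ ∃ i, (∀ j, i < j → ℓ j x = ℓ j y) ∧ ℓ i x < ℓ i y := by
    intro x y
    exact Iff.rfl
  have hΛ0 : ∀ x y, Λ x = Λ y ↔ s₀ x y := by
    intro x y
    refine ⟨fun h => (hℓ 0 x y).2 ?_, fun h => ?_⟩
    · exact DFunLike.congr_fun (show Λ' x = Λ' y from h) 0
    · have : Λ' x = Λ' y := Finsupp.ext fun i => (hℓ _ x y).1 (hT (Nat.zero_le _) h)
      exact congrArg toColex this
  have hinf : (Set.range Λ).Infinite := by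
    intro hcon
    have h1 : Finite (Set.range Λ) := hcon
    have h2 : Function.Injective (fun q : Quotient s₀ => (⟨Λ q.out, q.out, rfl⟩ : Set.range Λ)) := by
      intro q q' h
      have := (hΛ0 _ _).1 (congrArg Subtype.val h)
      exact Quotient.out_equiv_out.1 this
    exact not_finite_iff_infinite.2 inferInstance (Finite.of_injective _ h2)
  have hIio : ∀ r ∈ Set.range Λ, (Set.range Λ ∩ Set.Iio r).Finite := by
    rintro _ ⟨x, rfl⟩
    obtain ⟨n, hn⟩ := htop x₀ x
    have hm : ∀ j, n + 1 ≤ j → ℓ j x = 0 := fun j hj => by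
      rw [← hℓ0 j]
      exact ((hℓ j x₀ x).1 (hT hj hn)).symm
    have h1 : (Λ '' {y | S n x₀ y}).Finite := by
      refine ((hfin n x₀).image fun q => Λ q.out).subset ?_
      rintro _ ⟨y, hy, rfl⟩
      exact ⟨_, ⟨y, hy, rfl⟩, (hΛ0 _ _).2 (Quotient.mk_out y)⟩
    refine h1.subset ?_
    rintro _ ⟨⟨y, rfl⟩, hy⟩
    obtain ⟨i, hi, hi'⟩ := (hlt y x).1 hy
    -- The labels of `x` vanish from index `n + 1` on, so a smaller label there is impossible.
    -- Everything below `x` thus lies in the `S n`-class of `x₀`, which is finite modulo `s₀`.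
    have hin : i < n + 1 := by
      by_contra hcon
      rw [hm i (not_lt.1 hcon)] at hi'
      omega
    refine ⟨y, (hℓ (n + 1) x₀ y).2 ?_, rfl⟩
    rw [hℓ0, hi _ hin, hm _ le_rfl]
  obtain ⟨h, hh, hr⟩ := exists_strictMono_range_eq hinf hIio
  have hg : ∀ n, ∃ x, Λ x = h n := fun n => by
    have : h n ∈ Set.range Λ := hr ▸ ⟨n, rfl⟩
    exact this
  choose g hg using hg
  refine ⟨g, fun x => ?_, fun p q hpq => ?_, fun n p q r hpq hqr hpr => ?_⟩
  · have : Λ x ∈ Set.range h := hr ▸ ⟨x, rfl⟩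
    obtain ⟨p, hp⟩ := this
    exact ⟨p, (hΛ0 _ _).1 (by rw [hg, hp])⟩
  · have := (hΛ0 _ _).2 hpq
    rw [hg, hg] at this
    exact hh.injective this
  · by_contra hcon
    have h1 : Λ (g p) ≤ Λ (g q) := by rw [hg, hg]; exact hh.monotone hpq
    have h2 : Λ (g q) ≤ Λ (g r) := by rw [hg, hg]; exact hh.monotone hqr
    have hne : ℓ (n + 1) (g p) ≠ ℓ (n + 1) (g q) := fun h => hcon ((hℓ (n + 1) _ _).2 h)
    have h3 : Λ (g p) < Λ (g q) := lt_of_le_of_ne h1 fun h =>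
      hcon (hT (Nat.zero_le (n + 1)) ((hΛ0 _ _).1 h))
    obtain ⟨i, hi, hi'⟩ := (hlt _ _).1 h3
    have hni : n + 1 ≤ i := by
      by_contra hlt'
      exact hne (hi _ (not_le.1 hlt'))
    have h4 : ∀ j, n + 1 ≤ j → ℓ j (g p) = ℓ j (g r) := fun j hj =>
      (hℓ j _ _).1 (hT hj hpr)
    refine absurd h2 (not_le.2 ((hlt _ _).2 ⟨i, fun j hj => ?_, ?_⟩))
    · rw [← h4 j (by omega), hi j hj]
    · rw [← h4 i hni]
      exact hi'

/-- `Γ` lists the least elements of the classes; by convexity the classes are the intervals between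
consecutive terms. -/
theorem exists_cuts {r : Setoid ℕ} (hconv : ∀ p q s, p ≤ q → q ≤ s → r p s → r p q)
    (hfin : ∀ p, {q | r q p}.Finite) :
    ∃ Γ : ℕ → ℕ, StrictMono Γ ∧ Γ 0 = 0 ∧ Set.range Γ = {p | ∀ q, r q p → p ≤ q} ∧
      (∀ p q, r p q ↔ lastIndex Γ p = lastIndex Γ q) ∧
        ∀ i, Γ i + {q | r q (Γ i)}.ncard = Γ (i + 1) := by
  classical
  let C : ℕ → Prop := fun p => ∀ q, r q p → p ≤ q
  have hmin : ∀ p, ∃ a, C a ∧ r p a ∧ a ≤ p := by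
    intro p
    have hex : ∃ a, r p a := ⟨p, r.refl' p⟩
    refine ⟨Nat.find hex, fun q hq => ?_, Nat.find_spec hex, Nat.find_min' hex (r.refl' p)⟩
    exact Nat.find_min' hex (r.trans' (Nat.find_spec hex) (r.symm' hq))
  have hinf : {a | C a}.Infinite := by
    intro hcon
    refine Set.infinite_univ (α := ℕ) ((hcon.biUnion fun a _ => hfin a).subset fun p _ => ?_)
    obtain ⟨a, ha, hpa, -⟩ := hmin p
    exact Set.mem_biUnion ha hpa
  have hΓ : StrictMono (Nat.nth C) := Nat.nth_strictMono hinf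
  have hrange : Set.range (Nat.nth C) = {a | C a} := Nat.range_nth_of_infinite hinf
  have h0 : Nat.nth C 0 = 0 := by
    have : C 0 := fun q _ => Nat.zero_le q
    simpa using Nat.nth_count this
  have hCnth : ∀ i, C (Nat.nth C i) := fun i => Nat.nth_mem_of_infinite hinf i
  have hlast : ∀ p, r p (Nat.nth C (lastIndex (Nat.nth C) p)) := by
    intro p
    obtain ⟨a, ha, hpa, hap⟩ := hmin p
    obtain ⟨j, rfl⟩ : a ∈ Set.range (Nat.nth C) := hrange ▸ ha
    have h1 := hΓ.monotone ((le_lastIndex_iff hΓ h0).2 hap)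
    exact r.trans' hpa (hconv _ _ _ h1 (apply_lastIndex_le hΓ h0 p) (r.symm' hpa))
  have hiff : ∀ p q, r p q ↔ lastIndex (Nat.nth C) p = lastIndex (Nat.nth C) q := by
    intro p q
    refine ⟨fun h => hΓ.injective (le_antisymm ?_ ?_), fun h => ?_⟩
    · exact hCnth _ _ (r.trans' (r.symm' (hlast q)) (r.trans' (r.symm' h) (hlast p)))
    · exact hCnth _ _ (r.trans' (r.symm' (hlast p)) (r.trans' h (hlast q)))
    · have := hlast p
      rw [h] at this
      exact r.trans' this (r.symm' (hlast q))
  refine ⟨Nat.nth C, hΓ, h0, hrange, hiff, fun i => ?_⟩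
  have hIco : {q | r q (Nat.nth C i)} = Set.Ico (Nat.nth C i) (Nat.nth C (i + 1)) := by
    ext q
    change r q _ ↔ _
    rw [hiff, lastIndex_apply hΓ h0]
    refine ⟨?_, fun h => lastIndex_eq hΓ h0 h.1 h.2⟩
    rintro rfl
    exact ⟨apply_lastIndex_le hΓ h0 q, lt_apply_lastIndex_add_one hΓ h0 q⟩
  rw [hIco, Set.ncard_eq_toFinset_card', Set.toFinset_Ico, Nat.card_Ico]
  have := hΓ (Nat.lt_add_one i)
  omega

theorem exists_cut_sequence {X : Type*} {s₀ : Setoid X} {S : ℕ → Setoid X}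
    (h0 : s₀ ≤ S 0) (hmono : Monotone S) (htop : ∀ x y, ∃ n, S n x y)
    (hfin : ∀ n x, (Quotient.mk s₀ '' {y | S n x y}).Finite) [Infinite (Quotient s₀)] :
    ∃ (P : X → ℕ) (Γ : ℕ → ℕ → ℕ), Function.Surjective P ∧ (∀ n, StrictMono (Γ n)) ∧
      (∀ n, Γ n 0 = 0) ∧ (∀ n i, ∃ j, Γ (n + 1) i = Γ n j) ∧
      (∀ n x y, S n x y ↔ lastIndex (Γ n) (P x) = lastIndex (Γ n) (P y)) ∧
      ∀ n i, ∃ x, Γ n i + (Quotient.mk s₀ '' {y | S n x y}).ncard = Γ n (i + 1) := by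
  obtain ⟨g, hg, hinj, hconv⟩ := exists_convex_enumeration h0 hmono htop hfin
  choose P hP using hg
  have hle : ∀ n, s₀ ≤ S n := fun n => h0.trans (hmono (Nat.zero_le n))
  have himg : ∀ n p, Quotient.mk s₀ '' {y | S n (g p) y} =
      (fun q => Quotient.mk s₀ (g q)) '' {q | S n (g q) (g p)} := by
    intro n p
    ext c
    constructor
    · rintro ⟨y, hy, rfl⟩
      refine ⟨P y, ?_, (Quotient.sound (hP y)).symm⟩
      exact (S n).symm' ((S n).trans' hy (hle n (hP y)))
    · rintro ⟨q, hq, rfl⟩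
      exact ⟨g q, (S n).symm' hq, rfl⟩
  have hginj : Function.Injective fun q => Quotient.mk s₀ (g q) := fun p q h =>
    hinj p q (Quotient.exact h)
  have hcuts := fun n => exists_cuts (r := (S n).comap g) (fun p q s => hconv n p q s) (fun p => by
    have h := hfin n (g p)
    rw [himg] at h
    exact h.of_finite_image hginj.injOn)
  choose Γ h1 h2 h3 h4 h5 using hcuts
  refine ⟨P, Γ, fun p => ⟨g p, (hinj _ _ (hP (g p))).symm⟩, h1, h2, fun n i => ?_,
    fun n x y => ?_, fun n i => ⟨g (Γ n i), ?_⟩⟩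
  · have h6 : Γ (n + 1) i ∈ Set.range (Γ (n + 1)) := ⟨i, rfl⟩
    rw [h3] at h6
    have h7 : Γ (n + 1) i ∈ Set.range (Γ n) := by
      rw [h3]
      exact fun q hq => h6 q (hmono (Nat.le_succ n) hq)
    obtain ⟨j, hj⟩ := h7
    exact ⟨j, hj.symm⟩
  · rw [← h4, Setoid.comap_rel]
    have hx := hle n (hP x)
    have hy := hle n (hP y)
    exact ⟨fun h => (S n).trans' ((S n).symm' hx) ((S n).trans' h hy),
      fun h => (S n).trans' hx ((S n).trans' h ((S n).symm' hy))⟩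
  · rw [himg, Set.ncard_image_of_injective _ hginj]
    exact h5 n i

/-! ### From interleaved cuts to a map -/

theorem exists_map_of_interleaved {X Y : Type*} {s₀ : Setoid X} {t₀ : Setoid Y}
    {S : ℕ → Setoid X} {R : ℕ → Setoid Y} (hS0 : s₀ ≤ S 0) (hR0 : t₀ ≤ R 0) (hS : Monotone S)
    (hR : Monotone R) (hStop : ∀ x y, ∃ n, S n x y) (hRtop : ∀ x y, ∃ n, R n x y)
    [Infinite (Quotient s₀)] [Infinite (Quotient t₀)]
    (hSfin : ∀ n x, (Quotient.mk s₀ '' {y | S n x y}).Finite)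
    (hRfin : ∀ n x, (Quotient.mk t₀ '' {y | R n x y}).Finite) {a b : ℕ → ℕ}
    (ha : ∀ n x, (Quotient.mk s₀ '' {y | S n x y}).ncard ≤ a n)
    (hb : ∀ n x, (Quotient.mk t₀ '' {y | R n x y}).ncard ≤ b n)
    (hab : ∀ n x, 2 ^ (2 * n + 3) * a n ≤ (Quotient.mk t₀ '' {y | R n x y}).ncard)
    (hba : ∀ n x, 2 ^ (2 * n + 4) * b n ≤ (Quotient.mk s₀ '' {y | S (n + 1) x y}).ncard) :
    ∃ f : X → Y, (∀ n x x', S n x x' → R n (f x) (f x')) ∧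
      (∀ n x x', R n (f x) (f x') → S (n + 1) x x') ∧ ∀ y, ∃ x, R 1 (f x) y := by
  obtain ⟨P, A, hP, hA, hA0, hAsub, hAiff, hAcard⟩ := exists_cut_sequence hS0 hS hStop hSfin
  obtain ⟨Q, B, hQ, hB, hB0, hBsub, hBiff, hBcard⟩ := exists_cut_sequence hR0 hR hRtop hRfin
  -- The levels alternate between the towers: `S 0`, `R 0`, `S 1`, `R 1`, and so on. The exponents
  -- `2 * n + 3` and `2 * n + 4` are `k + 3` for `k = 2 * n` and `k = 2 * n + 1`.
  let Γ : ℕ → ℕ → ℕ := fun k => if k % 2 = 0 then A (k / 2) else B (k / 2)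
  let M : ℕ → ℕ := fun k => if k % 2 = 0 then a (k / 2) else b (k / 2)
  have hΓ0 : ∀ n, Γ (2 * n) = A n := fun n => by simp [Γ]
  have hΓ1 : ∀ n, Γ (2 * n + 1) = B n := fun n => by
    simp only [Γ, if_neg (show ¬ (2 * n + 1) % 2 = 0 by omega), show (2 * n + 1) / 2 = n by omega]
  have hM0 : ∀ n, M (2 * n) = a n := fun n => by simp [M]
  have hM1 : ∀ n, M (2 * n + 1) = b n := fun n => by
    simp only [M, if_neg (show ¬ (2 * n + 1) % 2 = 0 by omega), show (2 * n + 1) / 2 = n by omega]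
  have hΓ2 : ∀ n, Γ (2 * n + 2) = A (n + 1) := fun n => hΓ0 (n + 1)
  have hΓ3 : ∀ n, Γ (2 * n + 1 + 2) = B (n + 1) := fun n => hΓ1 (n + 1)
  obtain ⟨σ, hσ, hσ0, hσ'⟩ := exists_interleaving (Γ := Γ) (M := M)
    (fun k => by
      obtain ⟨n, rfl | rfl⟩ := Nat.even_or_odd' k
      · rw [hΓ0]; exact hA n
      · rw [hΓ1]; exact hB n)
    (fun k => by
      obtain ⟨n, rfl | rfl⟩ := Nat.even_or_odd' k
      · rw [hΓ0]; exact hA0 n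
      · rw [hΓ1]; exact hB0 n)
    (fun k => by
      obtain ⟨n, rfl | rfl⟩ := Nat.even_or_odd' k
      · rw [hΓ2, hΓ0]; exact hAsub n
      · rw [hΓ3, hΓ1]; exact hBsub n)
    (fun k i => by
      obtain ⟨n, rfl | rfl⟩ := Nat.even_or_odd' k
      · rw [hΓ0, hM0]
        obtain ⟨x, hx⟩ := hAcard n i
        have := ha n x
        omega
      · rw [hΓ1, hM1]
        obtain ⟨x, hx⟩ := hBcard n i
        have := hb n x
        omega)
    (fun k i => by
      obtain ⟨n, rfl | rfl⟩ := Nat.even_or_odd' k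
      · rw [hΓ1, hM0]
        obtain ⟨x, hx⟩ := hBcard n i
        rw [← hx]
        exact Nat.add_le_add_left (hab n x) _
      · rw [hΓ2, hM1]
        obtain ⟨x, hx⟩ := hAcard (n + 1) i
        rw [← hx]
        exact Nat.add_le_add_left (hba n x) _)
  let α : ℕ → X → ℕ := fun n x => lastIndex (A n) (P x)
  let β : ℕ → Y → ℕ := fun n y => lastIndex (B n) (Q y)
  have hcomp : ∀ k p, lastIndex (Γ (k + 2)) p = lastIndex (σ (k + 1)) (lastIndex (σ k)
      (lastIndex (Γ k) p)) := by
    intro k p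
    have hΓk : StrictMono (Γ k) ∧ Γ k 0 = 0 := by
      obtain ⟨n, rfl | rfl⟩ := Nat.even_or_odd' k
      · rw [hΓ0]; exact ⟨hA n, hA0 n⟩
      · rw [hΓ1]; exact ⟨hB n, hB0 n⟩
    have h1 : Γ (k + 2) = Γ k ∘ (σ k ∘ σ (k + 1)) := funext fun j => (hσ' k j).symm
    rw [h1, lastIndex_comp hΓk.1 hΓk.2 ((hσ k).comp (hσ (k + 1))) (by simp [hσ0]),
      lastIndex_comp (hσ k) (hσ0 k) (hσ (k + 1)) (hσ0 _)]
  have hα : ∀ n x, α (n + 1) x = lastIndex (σ (2 * n + 1)) (lastIndex (σ (2 * n)) (α n x)) := by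
    intro n x
    have := hcomp (2 * n) (P x)
    rwa [hΓ2, hΓ0] at this
  have hβ : ∀ n y, β (n + 1) y =
      lastIndex (σ (2 * (n + 1))) (lastIndex (σ (2 * n + 1)) (β n y)) := by
    intro n y
    have := hcomp (2 * n + 1) (Q y)
    rwa [hΓ3, hΓ1] at this
  have hαs : ∀ n j, ∃ x, α n x = j := fun n j => by
    obtain ⟨x, hx⟩ := hP (A n j)
    exact ⟨x, by simp only [α, hx, lastIndex_apply (hA n) (hA0 n)]⟩
  have hf : ∀ x, ∃ y, β 0 y = lastIndex (σ 0) (α 0 x) := fun x => by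
    obtain ⟨y, hy⟩ := hQ (B 0 (lastIndex (σ 0) (α 0 x)))
    exact ⟨y, by simp only [β, hy, lastIndex_apply (hB 0) (hB0 0)]⟩
  choose f hf using hf
  -- The adjoints of the `σ k` map class indices of each level to the next, and two of them compose
  -- to the projection within one tower. Hence prescribing `f` at level 0 determines it at all
  -- levels.
  have hβf : ∀ n x, β n (f x) = lastIndex (σ (2 * n)) (α n x) := by
    intro n x
    induction n with
    | zero => exact hf x
    | succ n ih => rw [hβ, ih, ← hα]
  refine ⟨f, fun n x x' h => ?_, fun n x x' h => ?_, fun y => ?_⟩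
  · rw [hBiff]
    rw [hAiff] at h
    change β n (f x) = β n (f x')
    rw [hβf, hβf]
    exact congrArg _ h
  · rw [hAiff]
    rw [hBiff] at h
    change α (n + 1) x = α (n + 1) x'
    rw [hα, hα, ← hβf, ← hβf]
    exact congrArg _ h
  · obtain ⟨x, hx⟩ := hαs 1 (lastIndex (σ (2 * 0 + 1)) (β 0 y))
    refine ⟨x, (hBiff _ _ _).2 ?_⟩
    change β 1 (f x) = β (0 + 1) y
    rw [hβf, hx, hβ]

theorem exists_seq_of_forall_exists {α : Type*} {P : ℕ → α → Prop} {R : ℕ → α → α → Prop}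
    (h0 : ∃ a, P 0 a) (h : ∀ n a, P n a → ∃ b, P (n + 1) b ∧ R n a b) :
    ∃ f : ℕ → α, (∀ n, P n (f n)) ∧ ∀ n, R n (f n) (f (n + 1)) := by
  choose g hg using h
  let F : ∀ n, {a // P n a} := fun n =>
    Nat.rec ⟨h0.choose, h0.choose_spec⟩ (fun n a => ⟨g n a.1 a.2, (hg n a.1 a.2).1⟩) n
  exact ⟨fun n => (F n).1, fun n => (F n).2, fun n => (hg n (F n).1 (F n).2).2⟩

/-! ### The case of countable cov♯ -/

namespace Ballean

variable {X Y : Type u} {E : Ballean X} {F : Ballean Y}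

theorem exists_isSmall_le_classCount (hne : E.radii.Nonempty) (hE : E.IsCellular)
    (hH : E.IsHomogeneous) (hcof : ℵ₀ ≤ E.cof) {s₀ s b : Setoid X} (hs₀ : E.IsSmall s₀)
    (hs : E.IsSmall s) (hb : E.IsSmall b) (n : ℕ) :
    ∃ t, E.IsSmall t ∧ s ≤ t ∧ b ≤ t ∧ ∀ x, (n : Cardinal) ≤ classCount s₀ {y | t x y} := by
  obtain ⟨t, ht, -, hn⟩ := hH.exists_le_classCount hE hs₀ (c := n)
    (natCast_lt_aleph0.trans_le (aleph0_le_covSharp hne hH hE hcof))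
  refine ⟨s ⊔ b ⊔ t, hE.isSmall_sup (hE.isSmall_sup hs hb) ht, le_sup_left.trans le_sup_left,
    le_sup_right.trans le_sup_left, fun x => (hn x).trans (classCount_mono _ fun y hy => ?_)⟩
  exact (le_sup_right : t ≤ s ⊔ b ⊔ t) hy

theorem infinite_quotient (hne : E.radii.Nonempty) (hE : E.IsCellular) (hH : E.IsHomogeneous)
    (hcof : ℵ₀ ≤ E.cof) {s₀ : Setoid X} (hs₀ : E.IsSmall s₀) : Infinite (Quotient s₀) := by
  rw [Cardinal.infinite_iff]
  by_contra! hcon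
  obtain ⟨n, hn⟩ := lt_aleph0.1 hcon
  obtain ⟨t, -, -, -, h⟩ := exists_isSmall_le_classCount hne hE hH hcof hs₀ hs₀ hs₀ (n + 1)
  obtain ⟨ε, hε⟩ := hne
  obtain ⟨x, -⟩ := exists_not_mem_radius hcof hε
  have h1 := (h x).trans (mk_set_le _)
  rw [hn] at h1
  exact absurd (Nat.cast_le.1 h1) (by omega)

theorem coarselyEquivalent_of_le_aleph0 (hne : E.radii.Nonempty) (hneF : F.radii.Nonempty)
    (hE : E.IsCellular) (hEO : E.IsOrdinal) (hEH : E.IsHomogeneous)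
    (hF : F.IsCellular) (hFH : F.IsHomogeneous) (hcofE : ℵ₀ ≤ E.cof)
    (hcof : E.cof = F.cof) (hcov : E.covSharp = F.covSharp) (hle : E.covSharp ≤ ℵ₀) :
    E.CoarselyEquivalent F := by
  have hcofE' := cof_eq_aleph0 hne hEH hE hEO hcofE hle
  have hcofF : ℵ₀ ≤ F.cof := hcof ▸ hcofE
  obtain ⟨s₀, hs₀, hsup⟩ := hE.exists_classCount_le hne
  obtain ⟨t₀, ht₀, htup⟩ := hF.exists_classCount_le hneF
  have hsup' : ∀ s, E.IsSmall s → ∃ n : ℕ, ∀ x, classCount s₀ {y | s x y} ≤ n := fun s hs => by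
    obtain ⟨c, hc, h⟩ := hsup s hs
    obtain ⟨n, rfl⟩ := lt_aleph0.1 (hc.trans_le hle)
    exact ⟨n, h⟩
  have htup' : ∀ s, F.IsSmall s → ∃ n : ℕ, ∀ x, classCount t₀ {y | s x y} ≤ n := fun s hs => by
    obtain ⟨c, hc, h⟩ := htup s hs
    obtain ⟨n, rfl⟩ := lt_aleph0.1 (hc.trans_le (hcov ▸ hle))
    exact ⟨n, h⟩
  have := infinite_quotient hne hE hEH hcofE hs₀
  have := infinite_quotient hneF hF hFH hcofF ht₀
  obtain ⟨b, hb, hb'⟩ := hE.exists_cofinal (ι := ℕ) (by simp [hcofE'])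
  obtain ⟨d, hd, hd'⟩ := hF.exists_cofinal (ι := ℕ) (by simp [← hcof, hcofE'])
  -- A state records one level of both towers with upper bounds for its counts. In each step the
  -- relation on `X` is chosen first, and the one on `Y` is then made large relative to its bound.
  let Good : ℕ → Setoid X × Setoid Y × ℕ × ℕ → Prop := fun n q =>
    (E.IsSmall q.1 ∧ s₀ ≤ q.1 ∧ ∀ x, classCount s₀ {y | q.1 x y} ≤ q.2.2.1) ∧
      (F.IsSmall q.2.1 ∧ t₀ ≤ q.2.1 ∧ ∀ x, classCount t₀ {y | q.2.1 x y} ≤ q.2.2.2) ∧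
        ∀ x, ((2 ^ (2 * n + 3) * q.2.2.1 : ℕ) : Cardinal) ≤ classCount t₀ {y | q.2.1 x y}
  let Next : ℕ → Setoid X × Setoid Y × ℕ × ℕ → Setoid X × Setoid Y × ℕ × ℕ → Prop := fun n q q' =>
    q.1 ≤ q'.1 ∧ q.2.1 ≤ q'.2.1 ∧ b n ≤ q'.1 ∧ d n ≤ q'.2.1 ∧
      ∀ x, ((2 ^ (2 * n + 4) * q.2.2.2 : ℕ) : Cardinal) ≤ classCount s₀ {y | q'.1 x y}
  obtain ⟨f, hf, hf'⟩ := exists_seq_of_forall_exists (P := Good) (R := Next) (by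
      obtain ⟨m, hm⟩ := hsup' s₀ hs₀
      obtain ⟨r, hr, h1, -, h2⟩ := exists_isSmall_le_classCount hneF hF hFH hcofF ht₀ ht₀ ht₀
        (2 ^ (2 * 0 + 3) * m)
      obtain ⟨m', hm'⟩ := htup' r hr
      exact ⟨(s₀, r, m, m'), ⟨hs₀, le_rfl, hm⟩, ⟨hr, h1, hm'⟩, h2⟩)
    (by
      rintro n ⟨s, t, m, m'⟩ ⟨⟨h1, h2, h3⟩, ⟨h4, h5, h6⟩, h7⟩
      obtain ⟨s', g1, g2, g3, g4⟩ := exists_isSmall_le_classCount hne hE hEH hcofE hs₀ h1 (hb n)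
        (2 ^ (2 * n + 4) * m')
      obtain ⟨k, hk⟩ := hsup' s' g1
      obtain ⟨t', k1, k2, k3, k4⟩ := exists_isSmall_le_classCount hneF hF hFH hcofF ht₀ h4 (hd n)
        (2 ^ (2 * (n + 1) + 3) * k)
      obtain ⟨k', hk'⟩ := htup' t' k1
      exact ⟨(s', t', k, k'), ⟨⟨g1, h2.trans g2, hk⟩, ⟨k1, h5.trans k2, hk'⟩, k4⟩,
        g2, k2, g3, k3, g4⟩)
  have hSfin : ∀ n x, (Quotient.mk s₀ '' {y | (f n).1 x y}).Finite := fun n x =>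
    lt_aleph0_iff_set_finite.1 (((hf n).1.2.2 x).trans_lt natCast_lt_aleph0)
  have hRfin : ∀ n x, (Quotient.mk t₀ '' {y | (f n).2.1 x y}).Finite := fun n x =>
    lt_aleph0_iff_set_finite.1 (((hf n).2.1.2.2 x).trans_lt natCast_lt_aleph0)
  obtain ⟨h, h1, h2, h3⟩ := exists_map_of_interleaved (s₀ := s₀) (t₀ := t₀)
    (S := fun n => (f n).1) (R := fun n => (f n).2.1) (hf 0).1.2.1 (hf 0).2.1.2.1
    (monotone_nat_of_le_succ fun n => (hf' n).1) (monotone_nat_of_le_succ fun n => (hf' n).2.1)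
    (fun x y => by
      obtain ⟨ε, hε, hxy⟩ := E.exists_radius_mem x y
      obtain ⟨i, hi⟩ := hb' ε hε
      exact ⟨i + 1, (hf' i).2.2.1 (hi _ _ hxy)⟩)
    (fun x y => by
      obtain ⟨ε, hε, hxy⟩ := F.exists_radius_mem x y
      obtain ⟨i, hi⟩ := hd' ε hε
      exact ⟨i + 1, (hf' i).2.2.2.1 (hi _ _ hxy)⟩)
    hSfin hRfin (a := fun n => (f n).2.2.1) (b := fun n => (f n).2.2.2)
    (fun n x => by
      have := (hf n).1.2.2 x
      rw [classCount, ← Set.cast_ncard (hSfin n x)] at this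
      exact Nat.cast_le.1 this)
    (fun n x => by
      have := (hf n).2.1.2.2 x
      rw [classCount, ← Set.cast_ncard (hRfin n x)] at this
      exact Nat.cast_le.1 this)
    (fun n x => by
      have := (hf n).2.2 x
      rw [classCount, ← Set.cast_ncard (hRfin n x)] at this
      exact Nat.cast_le.1 this)
    (fun n x => by
      have := (hf' n).2.2.2.2 x
      rw [classCount, ← Set.cast_ncard (hSfin (n + 1) x)] at this
      exact Nat.cast_le.1 this)
  refine IsCoarseEmbedding.coarselyEquivalent (f := h) ⟨fun ε hε => ?_, fun δ hδ => ?_⟩ ?_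
  · obtain ⟨i, hi⟩ := hb' ε hε
    obtain ⟨δ, hδ, g⟩ := (hf (i + 1)).2.1.1
    exact ⟨δ, hδ, fun x x' hx => g _ _ (h1 _ _ _ ((hf' i).2.2.1 (hi _ _ hx)))⟩
  · obtain ⟨i, hi⟩ := hd' δ hδ
    obtain ⟨ε, hε, g⟩ := (hf (i + 1 + 1)).1.1
    exact ⟨ε, hε, fun x x' hx => g _ _ (h2 _ _ _ ((hf' i).2.2.2.1 (hi _ _ hx)))⟩
  · obtain ⟨δ, hδ, g⟩ := (hf 1).2.1.1
    exact ⟨δ, hδ, fun y => (h3 y).imp fun x hx => g _ _ hx⟩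

/-! ### Bounded balleans and the final case distinction -/

theorem coarselyEquivalent_of_cof_lt (hne : E.radii.Nonempty) (hneF : F.radii.Nonempty)
    (hcofE : E.cof < ℵ₀) (hcof : E.cof = F.cof) (hcov : E.covSharp = F.covSharp) :
    E.CoarselyEquivalent F := by
  obtain ⟨ε, hε, hε'⟩ := exists_radius_of_cof_lt hne hcofE
  obtain ⟨δ, hδ, hδ'⟩ := exists_radius_of_cof_lt hneF (hcof ▸ hcofE)
  have hiff : IsEmpty X ↔ IsEmpty Y := by
    rw [← covSharp_le_one_iff hne, ← covSharp_le_one_iff hneF, hcov]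
  rcases isEmpty_or_nonempty X with hX | hX
  · have hY := hiff.1 hX
    exact IsCoarseEmbedding.coarselyEquivalent (f := fun x => isEmptyElim x)
      ⟨fun _ _ => ⟨δ, hδ, fun x => isEmptyElim x⟩, fun _ _ => ⟨ε, hε, fun x => isEmptyElim x⟩⟩
      ⟨δ, hδ, fun y => isEmptyElim y⟩
  · have hY : Nonempty Y := by
      by_contra hcon
      exact not_isEmpty_iff.2 hX (hiff.2 (not_nonempty_iff.1 hcon))
    obtain ⟨x₀⟩ := hX
    obtain ⟨y₀⟩ := hY
    exact IsCoarseEmbedding.coarselyEquivalent (f := fun _ => y₀)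
      ⟨fun _ _ => ⟨δ, hδ, fun x x' _ => hδ' _ _⟩, fun _ _ => ⟨ε, hε, fun x x' _ => hε' _ _⟩⟩
      ⟨δ, hδ, fun y => ⟨x₀, hδ' _ _⟩⟩

end Ballean

theorem mainTheorem3 {X Y : Type u} (E : Ballean X) (F : Ballean Y)
    (hE : E.radii.Nonempty) (hF : F.radii.Nonempty)
    (hE_cell : E.IsCellular) (hE_ord : E.IsOrdinal) (hE_hom : E.IsHomogeneous)
    (hF_cell : F.IsCellular) (hF_ord : F.IsOrdinal) (hF_hom : F.IsHomogeneous) :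
    List.TFAE [
      E.CoarselyEquivalent F,
      (∃ A : Set Y, E.CoarselyEquivalent (F.sub A)) ∧
        (∃ A : Set X, F.CoarselyEquivalent (E.sub A)),
      E.cof = F.cof ∧ E.covSharp = F.covSharp] := by
  tfae_have 1 → 2 := fun h => ⟨⟨_, h.sub_univ⟩, ⟨_, h.symm.sub_univ⟩⟩
  tfae_have 2 → 3 := by
    rintro ⟨⟨A, hA⟩, B, hB⟩
    obtain ⟨f, hf⟩ := hA.exists_isCoarseEmbedding_of_sub
    obtain ⟨g, hg⟩ := hB.exists_isCoarseEmbedding_of_sub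
    exact ⟨le_antisymm hf.cof_le hg.cof_le,
      le_antisymm (hf.covSharp_le hF) (hg.covSharp_le hE)⟩
  tfae_have 3 → 1 := by
    rintro ⟨hcof, hcov⟩
    rcases lt_or_ge E.cof ℵ₀ with hlt | hge
    · exact Ballean.coarselyEquivalent_of_cof_lt hE hF hlt hcof hcov
    rcases le_or_gt E.covSharp ℵ₀ with hle | hgt
    · exact Ballean.coarselyEquivalent_of_le_aleph0 hE hF hE_cell hE_ord hE_hom hF_cell hF_hom
        hge hcof hcov hle
    · obtain ⟨ε, hε⟩ := hE
      obtain ⟨δ, hδ⟩ := hF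
      obtain ⟨x, -⟩ := Ballean.exists_not_mem_radius hge hε
      obtain ⟨y, -⟩ := Ballean.exists_not_mem_radius (hcof ▸ hge) hδ
      have : Nonempty X := ⟨x⟩
      have : Nonempty Y := ⟨y⟩
      exact Ballean.coarselyEquivalent_of_aleph0_lt ⟨ε, hε⟩ ⟨δ, hδ⟩ hE_cell hE_ord hE_hom hF_cell
        hF_ord hF_hom hcof hcov hgt
  tfae_finish
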